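/- **Notation.** Let $G$ be a simplicial group with faces $d_i$ and degeneracies $s_i$. Its Moore complex is $NG_n=\bigcap_{i=0}^{n-1}\ker (d_i:G_n\to G_{n-1})$ (so $NG_0=G_0$), with boundary $\partial_n:NG_n\to NG_{n-1}$ the restriction of $d_n$; $G_0$ acts on $NG_n$ by conjugation through the total degeneracy $G_0\to G_n$. For $n\ge 0$ let $S(n)$ be the set of tuples $\alpha=(i_l,\dots,i_1)$ with $0\le i_1<\dots<i_l\le n-1$ (equivalently, of monotone surjections $[n]\to[n-l]$), $\#\alpha=l$ and $s_\alpha=s_{i_l}\cdots s_{i_1}:G_{n-l}\to G_n$. It is ordered by: $\beta=(j_m,\dots,j_1)<\alpha=(i_l,\dots,i_1)$ if either $i_1=j_1,\dots,i_k=j_k$ and $i_{k+1}<j_{k+1}$ for some $k\ge 0$, or $i_1=j_1,\dots,i_m=j_m$ and $l>m$. Let $P(n)$ be the set of pairs $(\alpha,\beta)$ of non-empty tuples in $S(n)$ with $\alpha\cap\beta=\emptyset$ and $\beta<\alpha$. For $(\alpha,\beta)\in P(n)$ the Peiffer pairing is $$F^n_{\alpha,\beta}:NG_{n-\#\alpha}\times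 NG_{n-\#\beta}\to NG_n,\qquad F^n_{\alpha,\beta}(x,y)=p_{n-1}\cdots p_1p_0\,[s_\alpha x,s_\beta y],$$ where $p_j(z)=z\,(s_jd_jz)^{-1}$ and $[g,h]=ghg^{-1}h^{-1}$. A *crossed complex* $C$ consists of groups $C_n$ ($n\ge0$), homomorphisms $\partial_n:C_n\to C_{n-1}$ ($n\ge1$) with $\partial_{n-1}\partial_n=1$, and actions $(g,x)\mapsto{}^gx$ of $C_0$ on the groups $C_n$ ($n\ge 1$), for which all $\partial_n$ are equivariant ($C_0$ acting on itself by conjugation), such that ${}^{\partial_1 m}m'=mm'm^{-1}$ for $m,m'\in C_1$, and for $n\ge2$ the group $C_n$ is abelian and $\partial_1C_1$ acts trivially on it. Its *nerve* is the simplicial group whose $n$-simplices are the families $c=(c_f)$ indexed by the monotone maps $f:[k]\to[n]$, $k\ge0$, with $c_f\in C_k$, $c_f=1$ if $f$ is not injective, and $$\partial c_f=c_{f\delta_1}c_{f\delta_0}^{-1}\ (k=1),\qquad \partial c_f=c_{f\delta_2}c_{f\delta_0}c_{f\delta_1}^{-1}\ (k=2),\qquad \partial c_f=\prod_{i=0}^{k}c_{f\delta_i}^{(-1)^{k-i}}\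 (k\ge3),$$ where $\delta_i:[k-1]\to[k]$ is the injective monotone map that omits $i$. Simplicial operators act by precomposition, and the product is $(cc')_f=c_fc'_f$ for $k=0$ and $(cc')_f=c_f\cdot{}^{v}c'_f$ for $k\ge1$, where $v\in C_0$ is the value of $c$ on the last vertex $f(k)$. We say that *$G$ has Moore complex $NG$ a crossed complex* if $NG$, with the boundaries and the action of $G_0=NG_0$ above, is a crossed complex and its nerve is isomorphic to $G$ as a simplicial group. **Corollary 4.3.** A simplicial group $G$ has Moore complex $NG$ a crossed complex if and only if for all $n$, all $(\alpha,\beta)\in P(n)$ and all $x\in NG_{n-\#\alpha}$, $y\in NG_{n-\#\beta}$, the element $F^n_{\alpha,\beta}(x,y)$ is trivial. -/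

import Mathlib

open CategoryTheory Opposite Simplicial
open scoped commutatorElement

universe u

/-! ### The Moore complex and the Peiffer pairings of a simplicial group -/

namespace SimplicialGroup

variable (G : SimplicialObject GrpCat.{u})

/-- `NG_n`, the intersection of the kernels of `d_0, …, d_{n-1}` on `G_n`; in particular `NG_0 = G_0`. -/
def moore (n : ℕ) : Subgroup (G _⦋n⦌) :=
  match n with
  | 0 => ⊤
  | n + 1 => ⨅ i : Fin (n + 1), (G.δ i.castSucc).hom.ker

theorem mem_moore_succ {n : ℕ} {z : G _⦋n + 1⦌} :
    z ∈ moore G (n + 1) ↔ ∀ i : Fin (n + 1), G.δ i.castSucc z = 1 := by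
  simp [moore, Subgroup.mem_iInf, MonoidHom.mem_ker]

/-- The total degeneracy `G_0 → G_n`. -/
def totalDegeneracy (n : ℕ) : G _⦋0⦌ ⟶ G _⦋n⦌ :=
  G.map (SimplexCategory.const ⦋n⦌ ⦋0⦌ 0).op

/-- The operator `p_j(z) = z · (s_j d_j z)⁻¹` on `G_{n+1}`, for `0 ≤ j ≤ n`. -/
def projStep {n : ℕ} (j : Fin (n + 1)) (z : G _⦋n + 1⦌) : G _⦋n + 1⦌ :=
  z * (G.σ j (G.δ j.castSucc z))⁻¹

/-- The composite `p_{k-1} ⋯ p_1 p_0` on `G_{n+1}` (`p_0` is applied first). -/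
def projUpTo (n k : ℕ) (hk : k ≤ n + 1) (z : G _⦋n + 1⦌) : G _⦋n + 1⦌ :=
  match k with
  | 0 => z
  | k + 1 => projStep G ⟨k, hk⟩ (projUpTo n k (Nat.le_of_succ_le hk) z)

theorem projStep_self {n : ℕ} (j : Fin (n + 1)) (z : G _⦋n + 1⦌) :
    G.δ j.castSucc (projStep G j z) = 1 := by
  have h := ConcreteCategory.congr_hom (G.δ_comp_σ_self (i := j)) (G.δ j.castSucc z)
  simp only [ConcreteCategory.comp_apply, ConcreteCategory.id_apply] at h
  simp [projStep, h]

theorem projStep_of_lt {n : ℕ} (i j : Fin (n + 1)) (hij : i < j) (z : G _⦋n + 1⦌)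
    (hz : G.δ i.castSucc z = 1) : G.δ i.castSucc (projStep G j z) = 1 := by
  cases n with
  | zero => omega
  | succ m =>
    obtain ⟨j', rfl⟩ := Fin.exists_succ_eq.2 (Fin.ne_zero_of_lt hij)
    obtain ⟨i', rfl⟩ : ∃ i' : Fin (m + 1), i = i'.castSucc :=
      ⟨⟨i, by have := j'.2; simp [Fin.lt_def] at hij; omega⟩, rfl⟩
    have hle : i'.castSucc ≤ j'.castSucc := by
      simp only [Fin.lt_def, Fin.le_def, Fin.val_castSucc, Fin.val_succ] at hij ⊢; omega
    have h1 := ConcreteCategory.congr_hom (G.δ_comp_σ_of_le hle) (G.δ j'.succ.castSucc z)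
    have h2 := ConcreteCategory.congr_hom (G.δ_comp_δ hle) z
    simp only [ConcreteCategory.comp_apply] at h1 h2
    rw [hz, map_one] at h2
    have h3 : G.δ i'.castSucc (G.δ j'.succ.castSucc z) = 1 := h2
    rw [h3, map_one] at h1
    rw [projStep, map_mul, map_inv, hz, h1, inv_one, mul_one]

theorem projUpTo_mem (n k : ℕ) (hk : k ≤ n + 1) (z : G _⦋n + 1⦌) (i : Fin (n + 1))
    (hi : (i : ℕ) < k) : G.δ i.castSucc (projUpTo G n k hk z) = 1 := by
  induction k with
  | zero => omega
  | succ k ih =>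
    rcases Nat.lt_succ_iff_lt_or_eq.1 hi with h | h
    · exact projStep_of_lt G i ⟨k, hk⟩ h _ (ih (Nat.le_of_succ_le hk) h)
    · obtain rfl : i = ⟨k, hk⟩ := Fin.ext h
      exact projStep_self G _ _

/-- The projection `p = p_{n-1} ⋯ p_0 : G_n → NG_n`. -/
def mooreProj (n : ℕ) (z : G _⦋n⦌) : moore G n :=
  match n with
  | 0 => ⟨z, trivial⟩
  | n + 1 => ⟨projUpTo G n (n + 1) le_rfl z,
      (mem_moore_succ G).2 fun i => projUpTo_mem G n (n + 1) le_rfl z i i.2⟩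

/-- The index set `{i : α(i) = α(i+1)}` of a monotone map `α : [n] → [a]`.  When `α` is surjective
with index set `{i_1 < ⋯ < i_l}`, one has `α = σ^{i_1} ⋯ σ^{i_l}`, so that
`G.map α.op = s_{i_l} ⋯ s_{i_1}`. -/
def indexSet {n a : ℕ} (α : ⦋n⦌ ⟶ ⦋a⦌) : Finset (Fin n) :=
  Finset.univ.filter fun i => α.toOrderHom i.castSucc = α.toOrderHom i.succ

/-- The lexicographic order `β < α` on tuples of indices `α = (i_l, …, i_1)`, `β = (j_m, …, j_1)`
with `i_1 < ⋯ < i_l` and `j_1 < ⋯ < j_m`: either at the first place `k` where `(i_1, i_2, …)` and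
`(j_1, j_2, …)` differ one has `i_k < j_k`, or `(j_1, …, j_m)` is a proper initial segment of
`(i_1, …, i_l)`. -/
def indexLT {n : ℕ} (β α : Finset (Fin n)) : Prop :=
  List.Lex (fun j i => i < j) β.sort α.sort

/-- The set `P(n)`: pairs of surjections `α : [n] → [a]`, `β : [n] → [b]`, other than the identity,
with disjoint index sets and `β < α`. -/
structure IsPeifferPair {n a b : ℕ} (α : ⦋n⦌ ⟶ ⦋a⦌) (β : ⦋n⦌ ⟶ ⦋b⦌) : Prop where
  surjective_left : Function.Surjective α.toOrderHom
  surjective_right : Function.Surjective β.toOrderHom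
  nonempty_left : (indexSet α).Nonempty
  nonempty_right : (indexSet β).Nonempty
  disjoint : Disjoint (indexSet α) (indexSet β)
  lt : indexLT (indexSet β) (indexSet α)

/-- The Peiffer pairing `F_{α,β}(x,y) = p [s_α x, s_β y]`, with `[g, h] = g h g⁻¹ h⁻¹`. -/
def peifferPairing {n a b : ℕ} (α : ⦋n⦌ ⟶ ⦋a⦌) (β : ⦋n⦌ ⟶ ⦋b⦌)
    (x : moore G a) (y : moore G b) : moore G n :=
  mooreProj G n ⁅G.map α.op (x : G _⦋a⦌), G.map β.op (y : G _⦋b⦌)⁆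

end SimplicialGroup

/-! ### Crossed complexes -/

/-- A (reduced) crossed complex `⋯ → C_2 → C_1 → C_0`, indexed from `0`: `C_n` is the term
usually written `ρ_{n+1}`.  The group `C_0` acts on every `C_n`, `n ≥ 1`. -/
structure CrossedComplex where
  obj : ℕ → Type u
  [grp : ∀ n, Group (obj n)]
  d : ∀ n, obj (n + 1) →* obj n
  act : ∀ n, obj 0 →* MulAut (obj (n + 1))
  /-- the boundaries are equivariant (for the conjugation action of `C_0` on itself) -/
  d_act_zero : ∀ (p : obj 0) (m : obj 1), d 0 (act 0 p m) = p * d 0 m * p⁻¹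
  d_act_succ : ∀ (n : ℕ) (p : obj 0) (x : obj (n + 2)),
    d (n + 1) (act (n + 1) p x) = act n p (d (n + 1) x)
  /-- the Peiffer identity, so that `d 0` is a crossed module -/
  peiffer : ∀ m m' : obj 1, act 0 (d 0 m) m' = m * m' * m⁻¹
  comm : ∀ (n : ℕ) (x y : obj (n + 2)), x * y = y * x
  /-- the action on `C_n`, `n ≥ 2`, factors through the cokernel of `d 0` -/
  act_d : ∀ (n : ℕ) (m : obj 1) (x : obj (n + 2)), act (n + 1) (d 0 m) x = x
  d_d : ∀ (n : ℕ) (x : obj (n + 2)), d n (d (n + 1) x) = 1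

namespace CrossedComplex

attribute [instance] CrossedComplex.grp

variable (C : CrossedComplex.{u})

instance commGroup (n : ℕ) : CommGroup (C.obj (n + 2)) :=
  { C.grp (n + 2) with mul_comm := C.comm n }

/-- The last vertex of a simplex of `Δ^n`. -/
def lastVertex {k n : ℕ} (f : ⦋k⦌ ⟶ ⦋n⦌) : Fin (n + 1) := f.toOrderHom (Fin.last k)

/-- An `n`-simplex of the nerve of a crossed complex: a labelling of the `k`-simplices of `Δ^n`
by elements of `C_k`, trivial on degenerate simplices, which satisfies the (homotopy addition)
boundary relations. -/
@[ext]
structure NerveSimplex (n : ℕ) where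
  vertex : Fin (n + 1) → C.obj 0
  label : ∀ k : ℕ, (⦋k + 1⦌ ⟶ ⦋n⦌) → C.obj (k + 1)
  label_degenerate : ∀ (k : ℕ) (f : ⦋k + 1⦌ ⟶ ⦋n⦌),
    ¬ Function.Injective f.toOrderHom → label k f = 1
  boundary_one : ∀ f : ⦋1⦌ ⟶ ⦋n⦌,
    C.d 0 (label 0 f) = vertex (f.toOrderHom 0) * (vertex (f.toOrderHom 1))⁻¹
  boundary_two : ∀ f : ⦋2⦌ ⟶ ⦋n⦌,
    C.d 1 (label 1 f) =
      label 0 (SimplexCategory.δ 2 ≫ f) * label 0 (SimplexCategory.δ 0 ≫ f) *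
        (label 0 (SimplexCategory.δ 1 ≫ f))⁻¹
  boundary_succ : ∀ (k : ℕ) (f : ⦋k + 3⦌ ⟶ ⦋n⦌),
    C.d (k + 2) (label (k + 2) f) =
      ∏ i : Fin (k + 4), label (k + 1) (SimplexCategory.δ i ≫ f) ^ ((-1 : ℤ) ^ (k + 3 + (i : ℕ)))

namespace NerveSimplex

variable {C} {n : ℕ}

/-- Two vertices joined by an edge act in the same way on `C_k`, `k ≥ 2`. -/
theorem act_vertex (c : NerveSimplex C n) (i j : Fin (n + 1)) (h : i ≤ j) (k : ℕ)
    (x : C.obj (k + 2)) : C.act (k + 1) (c.vertex i) x = C.act (k + 1) (c.vertex j) x := by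
  have h1 := c.boundary_one (SimplexCategory.mkOfLe i j h)
  have h2 : c.vertex i = C.d 0 (c.label 0 (SimplexCategory.mkOfLe i j h)) * c.vertex j := by
    rw [h1]; change _ = (c.vertex i * (c.vertex j)⁻¹) * _; group
  rw [h2, map_mul, MulAut.mul_apply, C.act_d]

theorem act_face (c : NerveSimplex C n) {k m : ℕ} (f : ⦋k + 1⦌ ⟶ ⦋n⦌) (i : Fin (k + 2))
    (x : C.obj (m + 2)) :
    C.act (m + 1) (c.vertex (lastVertex (SimplexCategory.δ i ≫ f))) x =
      C.act (m + 1) (c.vertex (lastVertex f)) x :=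
  c.act_vertex _ _ (f.toOrderHom.monotone (Fin.le_last _)) _ _

theorem act_face_inv (c : NerveSimplex C n) {k m : ℕ} (f : ⦋k + 1⦌ ⟶ ⦋n⦌) (i : Fin (k + 2))
    (x : C.obj (m + 2)) :
    C.act (m + 1) (c.vertex (lastVertex (SimplexCategory.δ i ≫ f)))⁻¹ x =
      C.act (m + 1) (c.vertex (lastVertex f))⁻¹ x := by
  rw [map_inv (C.act (m + 1)), map_inv (C.act (m + 1)), MulAut.inv_apply, MulEquiv.symm_apply_eq,
    c.act_face, MulAut.apply_inv_self]

/-- An edge of the labelling acts by conjugation on `C_1`. -/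
theorem act_edge (c : NerveSimplex C n) (f : ⦋1⦌ ⟶ ⦋n⦌) (m : C.obj 1) :
    C.act 0 (c.vertex (f.toOrderHom 0)) m =
      c.label 0 f * C.act 0 (c.vertex (f.toOrderHom 1)) m * (c.label 0 f)⁻¹ := by
  have h : c.vertex (f.toOrderHom 0) = C.d 0 (c.label 0 f) * c.vertex (f.toOrderHom 1) := by
    rw [c.boundary_one]; group
  rw [h, map_mul, MulAut.mul_apply, C.peiffer]

/-- The boundary of an element of `C_2` is central in `C_1`. -/
theorem d_one_central (x : C.obj 2) (m : C.obj 1) : C.d 1 x * m = m * C.d 1 x := by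
  have h := C.peiffer (C.d 1 x) m
  rw [C.d_d, map_one, MulAut.one_apply] at h
  conv_rhs => rw [h]
  group

instance : One (NerveSimplex C n) where
  one :=
    { vertex := fun _ => 1
      label := fun _ _ => 1
      label_degenerate := fun _ _ _ => rfl
      boundary_one := by simp
      boundary_two := by simp
      boundary_succ := by simp }

/-- The product of labellings: `(c c')_f = c_f · ^{v} c'_f` for a simplex `f` of positive dimension,
where `v = c_{last vertex of f}`, and the pointwise product on vertices. -/
instance : Mul (NerveSimplex C n) where
  mul c c' :=
    { vertex := fun i => c.vertex i * c'.vertex i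
      label := fun k f => c.label k f * C.act k (c.vertex (lastVertex f)) (c'.label k f)
      label_degenerate := fun k f hf => by
        simp [c.label_degenerate k f hf, c'.label_degenerate k f hf]
      boundary_one := fun f => by
        rw [map_mul, C.d_act_zero, c.boundary_one, c'.boundary_one]
        change _ * (c.vertex (f.toOrderHom 1) * _ * (c.vertex (f.toOrderHom 1))⁻¹) = _
        group
      boundary_two := fun f => by
        have hc := d_one_central (c.label 1 f)
        have e := c.act_edge (SimplexCategory.δ 0 ≫ f)
        change ∀ m, C.act 0 (c.vertex (f.toOrderHom 1)) m = _ *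
          C.act 0 (c.vertex (f.toOrderHom 2)) m * _ at e
        rw [map_mul, C.d_act_succ, c'.boundary_two, map_mul, map_mul, map_inv]
        change _ * (C.act 0 (c.vertex (f.toOrderHom 2)) _ * C.act 0 (c.vertex (f.toOrderHom 2)) _ *
          (C.act 0 (c.vertex (f.toOrderHom 2)) _)⁻¹) =
          (_ * C.act 0 (c.vertex (f.toOrderHom 1)) _) *
          (_ * C.act 0 (c.vertex (f.toOrderHom 2)) _) *
          (_ * C.act 0 (c.vertex (f.toOrderHom 2)) _)⁻¹
        have hm := d_one_central (C.act 1 (c.vertex (f.toOrderHom 2)) (c'.label 1 f))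
        rw [C.d_act_succ, c'.boundary_two, map_mul, map_mul, map_inv] at hm
        have h := hm (c.label 0 (SimplexCategory.δ 1 ≫ f))⁻¹
        rw [e, c.boundary_two, mul_assoc _ _⁻¹, ← h]
        group
      boundary_succ := fun k f => by
        rw [map_mul, C.d_act_succ, c.boundary_succ, c'.boundary_succ, map_prod,
          ← Finset.prod_mul_distrib]
        refine Finset.prod_congr rfl fun i _ => ?_
        rw [map_zpow, mul_zpow, c.act_face] }

instance : Inv (NerveSimplex C n) where
  inv c :=
    { vertex := fun i => (c.vertex i)⁻¹
      label := fun k f => C.act k (c.vertex (lastVertex f))⁻¹ (c.label k f)⁻¹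
      label_degenerate := fun k f hf => by simp [c.label_degenerate k f hf]
      boundary_one := fun f => by
        rw [C.d_act_zero, map_inv, c.boundary_one]
        change (c.vertex (f.toOrderHom 1))⁻¹ * _ * (c.vertex (f.toOrderHom 1))⁻¹⁻¹ = _
        group
      boundary_two := fun f => by
        have hc := d_one_central (c.label 1 f) (c.label 0 (SimplexCategory.δ 1 ≫ f))
        have e := c.act_edge (SimplexCategory.δ 0 ≫ f)
        change ∀ m, C.act 0 (c.vertex (f.toOrderHom 1)) m = _ *
          C.act 0 (c.vertex (f.toOrderHom 2)) m * _ at e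
        rw [C.d_act_succ, map_inv (C.d (0 + 1))]
        change C.act 0 (c.vertex (f.toOrderHom 2))⁻¹ _ =
          C.act 0 (c.vertex (f.toOrderHom 1))⁻¹ _ * C.act 0 (c.vertex (f.toOrderHom 2))⁻¹ _ *
          (C.act 0 (c.vertex (f.toOrderHom 2))⁻¹ _)⁻¹
        rw [c.boundary_two] at hc ⊢
        generalize c.label 0 (SimplexCategory.δ 0 ≫ f) = b at *
        generalize c.label 0 (SimplexCategory.δ 1 ≫ f) = x at *
        have key : C.act 0 (c.vertex (f.toOrderHom 1))⁻¹
            (c.label 0 (SimplexCategory.δ 2 ≫ f))⁻¹ =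
            C.act 0 (c.vertex (f.toOrderHom 2))⁻¹
              (b⁻¹ * (c.label 0 (SimplexCategory.δ 2 ≫ f))⁻¹ * b) := by
          rw [map_inv (C.act 0), MulAut.inv_apply, MulEquiv.symm_apply_eq, e, map_inv (C.act 0),
            MulAut.apply_inv_self]
          group
        rw [key]
        generalize c.label 0 (SimplexCategory.δ 2 ≫ f) = a at *
        rw [← map_mul, ← map_inv, ← map_mul]
        congr 1
        have h : a * b = x * (a * b) * x⁻¹ := by
          rw [inv_mul_cancel_right] at hc
          exact hc.trans (by group)
        have h' : x * (a * b)⁻¹ = (a * b)⁻¹ * x := by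
          conv_rhs => rw [h]
          group
        calc (a * b * x⁻¹)⁻¹ = x * (a * b)⁻¹ := by group
          _ = _ := by rw [h']; group
      boundary_succ := fun k f => by
        rw [C.d_act_succ, map_inv (C.d (k + 1 + 1)), c.boundary_succ, map_inv (C.act (k + 1) _), map_prod, ← Finset.prod_inv_distrib]
        refine Finset.prod_congr rfl fun i _ => ?_
        rw [c.act_face_inv, map_zpow, map_inv (C.act (k + 1) _), inv_zpow] }

@[simp] theorem one_vertex (i : Fin (n + 1)) : (1 : NerveSimplex C n).vertex i = 1 := rfl

@[simp] theorem one_label (k : ℕ) (f : ⦋k + 1⦌ ⟶ ⦋n⦌) :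
    (1 : NerveSimplex C n).label k f = 1 := rfl

@[simp] theorem mul_vertex (c c' : NerveSimplex C n) (i : Fin (n + 1)) :
    (c * c').vertex i = c.vertex i * c'.vertex i := rfl

@[simp] theorem mul_label (c c' : NerveSimplex C n) (k : ℕ) (f : ⦋k + 1⦌ ⟶ ⦋n⦌) :
    (c * c').label k f = c.label k f * C.act k (c.vertex (lastVertex f)) (c'.label k f) := rfl

@[simp] theorem inv_vertex (c : NerveSimplex C n) (i : Fin (n + 1)) :
    c⁻¹.vertex i = (c.vertex i)⁻¹ := rfl

@[simp] theorem inv_label (c : NerveSimplex C n) (k : ℕ) (f : ⦋k + 1⦌ ⟶ ⦋n⦌) :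
    c⁻¹.label k f = C.act k (c.vertex (lastVertex f))⁻¹ (c.label k f)⁻¹ := rfl

instance : Group (NerveSimplex C n) :=
  Group.ofLeftAxioms
    (fun a b c => by
      ext
      · simp [mul_assoc]
      · simp [mul_assoc])
    (fun a => by ext <;> simp)
    (fun a => by
      ext
      · simp
      · simp)

/-- Restriction of a labelling along a simplicial operator. -/
def restrict {m : ℕ} (θ : ⦋m⦌ ⟶ ⦋n⦌) : NerveSimplex C n →* NerveSimplex C m where
  toFun c :=
    { vertex := fun i => c.vertex (θ.toOrderHom i)
      label := fun k f => c.label k (f ≫ θ)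
      label_degenerate := fun k f hf => c.label_degenerate k _ fun h =>
        hf (Function.Injective.of_comp (f := θ.toOrderHom) h)
      boundary_one := fun f => c.boundary_one (f ≫ θ)
      boundary_two := fun f => by simpa using c.boundary_two (f ≫ θ)
      boundary_succ := fun k f => by simpa using c.boundary_succ k (f ≫ θ) }
  map_one' := rfl
  map_mul' _ _ := rfl

end NerveSimplex

/-- The nerve of a crossed complex, as a simplicial group. -/
def nerve : SimplicialObject GrpCat.{u} where
  obj m := GrpCat.of (NerveSimplex C m.unop.len)
  map θ := GrpCat.ofHom (NerveSimplex.restrict (C := C) θ.unop)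
  map_id X := by
    ext c : 2
    exact NerveSimplex.ext rfl
      (funext fun k => funext fun f => congrArg (c.label k) (Category.comp_id f))
  map_comp _ _ := rfl

end CrossedComplex

namespace SimplicialGroup

/-- The simplicial group `G` has Moore complex a crossed complex: there is a crossed complex `C`
which is identified with `NG`, the boundaries being those of `NG` and the action of `C_0 = G_0` on
`C_n = NG_n` being conjugation through the total degeneracy `G_0 → G_n`, and which corresponds to `G`
under the nerve, i.e. the nerve of `C` is isomorphic to `G`. -/
def MooreIsCrossedComplex (G : SimplicialObject GrpCat.{u}) : Prop :=
  ∃ (C : CrossedComplex.{u}) (e : ∀ n, C.obj n ≃* moore G n),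
    (∀ (n : ℕ) (x : C.obj (n + 1)),
      (e n (C.d n x) : G _⦋n⦌) = G.δ (Fin.last (n + 1)) (e (n + 1) x : G _⦋n + 1⦌)) ∧
    (∀ (n : ℕ) (p : C.obj 0) (x : C.obj (n + 1)),
      (e (n + 1) (C.act n p x) : G _⦋n + 1⦌) =
        totalDegeneracy G (n + 1) (e 0 p : G _⦋0⦌) * (e (n + 1) x : G _⦋n + 1⦌) *
          (totalDegeneracy G (n + 1) (e 0 p : G _⦋0⦌))⁻¹) ∧
    Nonempty (C.nerve ≅ G)

end SimplicialGroup

namespace SimplicialGroup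

/-! ### Monotone maps -/

/-! Both conditions are equivalent to a third, `MooreDegenTrivial`: NG_n ∩ D_n = 1 for all n, where
D_n ≤ G_n is generated by the degenerate elements.

In the nerve of a crossed complex a product of degenerate elements has trivial top label, while an
element of the Moore complex is determined by its top label, because the boundary relations recover
its last face; hence `nerve_mooreDegenTrivial`. Each p_j changes an element by a degenerate factor
and [s_α x, s_β y] lies in D_n, so F_{α,β}(x,y) lies in NG_n ∩ D_n and vanishes.

Conversely, filter D_n by the subgroups `degenFrom j`. Vanishing pairings make step j+1 stable under
conjugation by every s_α x with j ∈ α, so an element of step j is w · s_j y with w in step j+1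
(`exists_eq_mul_sigma`). If the element lies in NG_n, then d_j kills both it and w, so y = 1 and the
element lies in step j+1. The last step of the filtration is trivial (`eq_one_of_mem_degenFrom`).

Finally, assume NG_n ∩ D_n = 1. Two elements of D_n commute as soon as each face but the last kills
one of them, for then their commutator lies in NG_n ∩ D_n (`commute_of_faces`). Applied to suitable
degenerate elements and followed by the last face, this shows that elements of D_n act on NG_n
through their last vertex (`commute_lastVertex_inv_mul`) and that any x acts as the last degeneracy
of its last face (`commute_sigma_delta_last`). The crossed complex axioms follow, and p becomes a
crossed homomorphism, so that z ↦ (p(f^* z))_f is a homomorphism to the nerve; it is bijective by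
induction on the dimension. -/

theorem hom_ext_val {m n : ℕ} {f g : ⦋m⦌ ⟶ ⦋n⦌}
    (h : ∀ t, (f.toOrderHom t : ℕ) = (g.toOrderHom t : ℕ)) : f = g := by
  apply SimplexCategory.Hom.ext
  ext t
  exact h t

theorem delta_val {n : ℕ} (i : Fin (n + 2)) (t : Fin (n + 1)) :
    ((SimplexCategory.δ i).toOrderHom t : ℕ) = if (t : ℕ) < i then (t : ℕ) else t + 1 := by
  change ((i.succAbove t : Fin (n + 2)) : ℕ) = _
  simp only [Fin.succAbove, Fin.lt_def, Fin.val_castSucc]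
  split_ifs <;> simp

theorem sigma_val {n : ℕ} (i : Fin (n + 1)) (t : Fin (n + 2)) :
    ((SimplexCategory.σ i).toOrderHom t : ℕ) = if (t : ℕ) ≤ i then (t : ℕ) else t - 1 := by
  change ((i.predAbove t : Fin (n + 1)) : ℕ) = _
  simp only [Fin.predAbove, Fin.lt_def, Fin.val_castSucc]
  split_ifs <;> simp <;> omega

theorem comp_val {m n k : ℕ} (f : ⦋m⦌ ⟶ ⦋n⦌) (g : ⦋n⦌ ⟶ ⦋k⦌) (t : Fin (m + 1)) :
    (f ≫ g).toOrderHom t = g.toOrderHom (f.toOrderHom t) := rfl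

theorem sigma_not_injective {n : ℕ} (i : Fin (n + 1)) :
    ¬ Function.Injective (SimplexCategory.σ i).toOrderHom := by
  intro h
  have h1 : (SimplexCategory.σ i).toOrderHom i.castSucc =
      (SimplexCategory.σ i).toOrderHom i.succ := by
    apply Fin.ext; rw [sigma_val, sigma_val]; simp
  have := congrArg Fin.val (h h1)
  simp at this

variable (G : SimplicialObject GrpCat.{u})

/-! ### Simplicial operators as homomorphisms -/

/-- The operator `f^* : G_n → G_m` of a monotone map `f : [m] → [n]`. -/
def pull {m n : ℕ} (f : ⦋m⦌ ⟶ ⦋n⦌) : G _⦋n⦌ →* G _⦋m⦌ := (G.map f.op).hom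

theorem delta_eq_pull {n : ℕ} (i : Fin (n + 2)) (z : G _⦋n + 1⦌) :
    G.δ i z = pull G (SimplexCategory.δ i) z := rfl

theorem sigma_eq_pull {n : ℕ} (i : Fin (n + 1)) (z : G _⦋n⦌) :
    G.σ i z = pull G (SimplexCategory.σ i) z := rfl

theorem pull_comp {m n k : ℕ} (f : ⦋m⦌ ⟶ ⦋n⦌) (g : ⦋n⦌ ⟶ ⦋k⦌) (z : G _⦋k⦌) :
    pull G (f ≫ g) z = pull G f (pull G g z) := by
  simp [pull]

theorem pull_id {n : ℕ} (z : G _⦋n⦌) : pull G (𝟙 ⦋n⦌) z = z := by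
  simp [pull]

/-! ### The Moore complex -/

/-- Such an operator factors through d_i. With this form, iterated simplicial identities reduce to
finding a vertex that a composite map omits. -/
theorem pull_eq_one_of_mem_moore {m n : ℕ} {z : G _⦋n⦌} (hz : z ∈ moore G n) (f : ⦋m⦌ ⟶ ⦋n⦌)
    (i : ℕ) (hi : i < n) (hf : ∀ t, (f.toOrderHom t : ℕ) ≠ i) : pull G f z = 1 := by
  cases n with
  | zero => omega
  | succ n =>
    obtain ⟨g, rfl⟩ := SimplexCategory.eq_comp_δ_of_not_surjective' f (⟨i, by omega⟩ : Fin (n + 2))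
      (fun t h => hf t (congrArg Fin.val h))
    rw [pull_comp, show pull G (SimplexCategory.δ ⟨i, _⟩) z = 1 from
      (mem_moore_succ G).1 hz ⟨i, hi⟩, map_one]

theorem mem_moore_of {n : ℕ} {z : G _⦋n + 1⦌}
    (h : ∀ i : Fin (n + 1), pull G (SimplexCategory.δ i.castSucc) z = 1) : z ∈ moore G (n + 1) :=
  (mem_moore_succ G).2 h

theorem pull_last_mem_moore {n : ℕ} {z : G _⦋n + 1⦌} (hz : z ∈ moore G (n + 1)) :
    pull G (SimplexCategory.δ (Fin.last (n + 1))) z ∈ moore G n := by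
  cases n with
  | zero => trivial
  | succ n =>
    refine mem_moore_of G fun i => ?_
    rw [← pull_comp]
    refine pull_eq_one_of_mem_moore G hz _ i (by omega) fun t => ?_
    rw [comp_val, delta_val, delta_val]
    simp only [Fin.val_last, Fin.val_castSucc]
    split_ifs <;> omega

theorem moore_normal (n : ℕ) : (moore G n).Normal := by
  cases n with
  | zero => exact inferInstanceAs (⊤ : Subgroup _).Normal
  | succ n =>
    refine ⟨fun z hz g => mem_moore_of G fun i => ?_⟩
    have := (mem_moore_succ G).1 hz i
    rw [delta_eq_pull] at this
    simp [this]

/-! ### Degenerate elements -/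

/-- The subgroup of `G_n` generated by the degenerate elements. -/
def degen (n : ℕ) : Subgroup (G _⦋n⦌) :=
  Subgroup.closure {g | ∃ (m : ℕ) (f : ⦋n⦌ ⟶ ⦋m⦌) (z : G _⦋m⦌),
    ¬ Function.Injective f.toOrderHom ∧ pull G f z = g}

theorem pull_mem_degen {n m : ℕ} (f : ⦋n⦌ ⟶ ⦋m⦌) (hf : ¬ Function.Injective f.toOrderHom)
    (z : G _⦋m⦌) : pull G f z ∈ degen G n :=
  Subgroup.subset_closure ⟨m, f, z, hf, rfl⟩

theorem sigma_mem_degen {n : ℕ} (i : Fin (n + 1)) (z : G _⦋n⦌) :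
    pull G (SimplexCategory.σ i) z ∈ degen G (n + 1) :=
  pull_mem_degen G _ (sigma_not_injective i) z

/-- A non-injective monotone map factors through some σ_i, so single degeneracies already generate.
-/
theorem degen_induction {n : ℕ} {p : G _⦋n + 1⦌ → Prop} {z : G _⦋n + 1⦌}
    (hz : z ∈ degen G (n + 1)) (hσ : ∀ i x, p (pull G (SimplexCategory.σ i) x)) (one : p 1)
    (mul : ∀ x y, p x → p y → p (x * y)) (inv : ∀ x, p x → p x⁻¹) : p z := by
  refine Subgroup.closure_induction (p := fun x _ => p x) ?_ one (fun x y _ _ => mul x y)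
    (fun x _ => inv x) hz
  rintro _ ⟨m, f, x, hf, rfl⟩
  obtain ⟨i, g, rfl⟩ := SimplexCategory.eq_σ_comp_of_not_injective f hf
  rw [pull_comp]
  exact hσ i _

theorem degen_zero {z : G _⦋0⦌} (hz : z ∈ degen G 0) : z = 1 := by
  refine Subgroup.closure_induction (p := fun x _ => x = 1) ?_ rfl
    (fun x y _ _ hx hy => by simp [hx, hy]) (fun x _ hx => by simp [hx]) hz
  rintro _ ⟨m, f, x, hf, rfl⟩
  exact (hf fun a b _ => Subsingleton.elim (α := Fin 1) a b).elim

/-- The canonical projection differs from the identity by a product of degenerate elements. -/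
theorem projUpTo_inv_mul_mem_degen (n k : ℕ) (hk : k ≤ n + 1) (z : G _⦋n + 1⦌) :
    (projUpTo G n k hk z)⁻¹ * z ∈ degen G (n + 1) := by
  induction k with
  | zero => simp [projUpTo, one_mem]
  | succ k ih =>
    have h := ih (Nat.le_of_succ_le hk)
    rw [projUpTo, projStep, mul_inv_rev, inv_inv, mul_assoc]
    exact mul_mem (sigma_mem_degen G _ _) h

theorem mooreProj_inv_mul_mem_degen (n : ℕ) (z : G _⦋n⦌) :
    (mooreProj G n z : G _⦋n⦌)⁻¹ * z ∈ degen G n := by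
  cases n with
  | zero => simp [mooreProj, one_mem]
  | succ n => exact projUpTo_inv_mul_mem_degen G n (n + 1) le_rfl z

/-- No nontrivial element of the Moore complex is a product of degenerate elements. -/
def MooreDegenTrivial : Prop :=
  ∀ (n : ℕ) (z : G _⦋n⦌), z ∈ moore G n → z ∈ degen G n → z = 1

theorem not_injective_of_mem_indexSet {n a : ℕ} {α : ⦋n⦌ ⟶ ⦋a⦌} {i : Fin n}
    (hi : i ∈ indexSet α) : ¬ Function.Injective α.toOrderHom := by
  intro h
  have := congrArg Fin.val (h (Finset.mem_filter.1 hi).2)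
  simp at this

/-- The Peiffer pairings vanish when the Moore complex meets the degenerate elements trivially. -/
theorem peifferPairing_eq_one (hT : MooreDegenTrivial G) {n a b : ℕ} {α : ⦋n⦌ ⟶ ⦋a⦌}
    {β : ⦋n⦌ ⟶ ⦋b⦌} (h : IsPeifferPair α β) (x : moore G a) (y : moore G b) :
    peifferPairing G α β x y = 1 := by
  obtain ⟨i, hi⟩ := h.nonempty_left
  obtain ⟨j, hj⟩ := h.nonempty_right
  have hx := pull_mem_degen G α (not_injective_of_mem_indexSet hi) x
  have hy := pull_mem_degen G β (not_injective_of_mem_indexSet hj) y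
  apply Subtype.ext
  refine hT n _ (Subtype.prop _) ?_
  -- The commutator is in D_n, and the projection alters it only by an element of D_n.
  have hc : ⁅pull G α x, pull G β y⁆ ∈ degen G n :=
    mul_mem (mul_mem (mul_mem hx hy) (inv_mem hx)) (inv_mem hy)
  have h1 := mul_mem hc (inv_mem (mooreProj_inv_mul_mem_degen G n ⁅pull G α x, pull G β y⁆))
  rw [mul_inv_rev, inv_inv, mul_inv_cancel_left] at h1
  exact h1

end SimplicialGroup

namespace SimplicialGroup

/-! ### Surjections and their index sets -/

/-- A monotone surjection starts at 0 and rises by 0 or 1 at each step, by 0 exactly at its indices;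
hence it is the identity up to its first index. -/
theorem surjection_val_eq {n a : ℕ} {α : ⦋n⦌ ⟶ ⦋a⦌} (hα : Function.Surjective α.toOrderHom) {j : ℕ}
    (hj : ∀ i ∈ indexSet α, j ≤ (i : ℕ)) (t : Fin (n + 1)) (ht : (t : ℕ) ≤ j) :
    (α.toOrderHom t : ℕ) = t := by
  obtain ⟨t, htn⟩ := t
  have mono : ∀ {x y : Fin (n + 1)}, x ≤ y → (α.toOrderHom x : ℕ) ≤ α.toOrderHom y :=
    fun h => α.toOrderHom.monotone h
  induction t with
  | zero =>
    obtain ⟨s, hs⟩ := hα (0 : Fin (a + 1))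
    have := mono (Fin.mk_le_of_le_val (Nat.zero_le s) : (⟨0, htn⟩ : Fin (n + 1)) ≤ s)
    rw [hs] at this
    simpa using this
  | succ t ih =>
    simp only at ht ih
    have h1 := ih (by omega) (by omega)
    have h2 : (α.toOrderHom (⟨t, by omega⟩ : Fin (n + 1)) : ℕ) ≠
        α.toOrderHom ⟨t + 1, htn⟩ := fun h => by
      have := hj ⟨t, by omega⟩ (Finset.mem_filter.2 ⟨Finset.mem_univ _, Fin.ext h⟩)
      simp only at this
      omega
    have h3 := mono (Fin.mk_le_mk.2 (Nat.le_succ t) :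
      (⟨t, by omega⟩ : Fin (n + 1)) ≤ ⟨t + 1, htn⟩)
    by_contra hne
    obtain ⟨s, hs⟩ := hα (⟨t + 1, by
      have : (α.toOrderHom ⟨t + 1, htn⟩ : ℕ) < a + 1 := Fin.is_lt _
      simp only at hne; omega⟩ : Fin (a + 1))
    have hs' : (α.toOrderHom s : ℕ) = t + 1 := congrArg Fin.val hs
    rcases Nat.lt_or_ge s (t + 1) with h | h
    · have := mono (Fin.le_def.2 (by simp only; omega) : s ≤ (⟨t, by omega⟩ : Fin (n + 1)))
      omega
    · have := mono (Fin.le_def.2 h : (⟨t + 1, htn⟩ : Fin (n + 1)) ≤ s)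
      simp only at hne
      omega

/-- The smallest indices already decide: min α ≤ j < min β, and the tuple with the smaller first
index is the larger one. -/
theorem indexLT_of_lt {n : ℕ} {β α : Finset (Fin n)} {j : Fin n} (hj : j ∈ α)
    (hβ : β.Nonempty) (h : ∀ i ∈ β, j < i) : indexLT β α := by
  unfold indexLT
  have hs := Finset.pairwise_sort α (· ≤ ·)
  cases hα : α.sort with
  | nil =>
    rw [← Finset.mem_sort (· ≤ ·), hα] at hj
    simp at hj
  | cons i l =>
    cases hβ' : β.sort with
    | nil =>
      obtain ⟨b, hb⟩ := hβ
      rw [← Finset.mem_sort (· ≤ ·), hβ'] at hb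
      simp at hb
    | cons b l' =>
      refine List.Lex.rel (lt_of_le_of_lt (b := j) ?_ (h b ?_))
      · rw [← Finset.mem_sort (· ≤ ·), hα] at hj
        rw [hα] at hs
        rcases List.mem_cons.1 hj with rfl | hj
        · exact le_rfl
        · exact (List.pairwise_cons.1 hs).1 _ hj
      · rw [← Finset.mem_sort (· ≤ ·), hβ']
        simp

variable (G : SimplicialObject GrpCat.{u})

/-! ### The filtration by iterated kernels of faces -/

/-- The elements of `G_n` killed by all operators that omit some vertex `i < j`; for `j ≤ n` this is
`⋂_{i < j} ker d_i`. -/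
def kerBelow (n j : ℕ) : Subgroup (G _⦋n⦌) where
  carrier := {z | ∀ (m : ℕ) (f : ⦋m⦌ ⟶ ⦋n⦌) (i : ℕ), i < j → (∀ t, (f.toOrderHom t : ℕ) ≠ i) →
    pull G f z = 1}
  one_mem' _ _ _ _ _ := map_one _
  mul_mem' hx hy m f i hi hf := by rw [map_mul, hx m f i hi hf, hy m f i hi hf, one_mul]
  inv_mem' hx m f i hi hf := by rw [map_inv, hx m f i hi hf, inv_one]

theorem kerBelow_normal (n j : ℕ) : (kerBelow G n j).Normal :=
  ⟨fun _ hx g m f i hi hf => by rw [map_mul, map_mul, hx m f i hi hf, map_inv]; simp⟩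

theorem mem_kerBelow_of {n j : ℕ} {z : G _⦋n + 1⦌}
    (h : ∀ i : Fin (n + 2), (i : ℕ) < j → pull G (SimplexCategory.δ i) z = 1) (hj : j ≤ n + 1) :
    z ∈ kerBelow G (n + 1) j := by
  intro m f i hi hf
  obtain ⟨g, rfl⟩ := SimplexCategory.eq_comp_δ_of_not_surjective' f (⟨i, by omega⟩ : Fin (n + 2))
    (fun t h => hf t (congrArg Fin.val h))
  rw [pull_comp, h ⟨i, by omega⟩ hi, map_one]

/-- The subgroup generated by the `s_α x` with `x` in the Moore complex, all indices of `α`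
being at least `j`. -/
def genFrom (n j : ℕ) : Subgroup (G _⦋n⦌) :=
  Subgroup.closure {g | ∃ (a : ℕ) (α : ⦋n⦌ ⟶ ⦋a⦌) (x : G _⦋a⦌),
    Function.Surjective α.toOrderHom ∧ (∀ i ∈ indexSet α, j ≤ (i : ℕ)) ∧ x ∈ moore G a ∧
      pull G α x = g}

/-- The subgroup generated by the `s_α x` with `x` in the Moore complex, `α` not the identity,
and all indices of `α` at least `j`. -/
def degenFrom (n j : ℕ) : Subgroup (G _⦋n⦌) :=
  Subgroup.closure {g | ∃ (a : ℕ) (α : ⦋n⦌ ⟶ ⦋a⦌) (x : G _⦋a⦌),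
    Function.Surjective α.toOrderHom ∧ (indexSet α).Nonempty ∧ (∀ i ∈ indexSet α, j ≤ (i : ℕ)) ∧
      x ∈ moore G a ∧ pull G α x = g}

theorem degenFrom_le_genFrom (n j : ℕ) : degenFrom G n j ≤ genFrom G n j :=
  Subgroup.closure_mono fun _ ⟨a, α, x, h1, _, h3, h4, h5⟩ => ⟨a, α, x, h1, h3, h4, h5⟩

theorem degenFrom_anti (n : ℕ) {j k : ℕ} (h : j ≤ k) : degenFrom G n k ≤ degenFrom G n j :=
  Subgroup.closure_mono fun _ ⟨a, α, x, h1, h2, h3, h4, h5⟩ =>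
    ⟨a, α, x, h1, h2, fun i hi => h.trans (h3 i hi), h4, h5⟩

/-- A surjection α with indices at least j fixes the vertices below j and maps the others to
vertices ≥ j. A map omitting i < j therefore still omits i after composition with α, and kills the
Moore element. -/
theorem degenFrom_le_kerBelow {n j : ℕ} (hj : j ≤ n) : degenFrom G n j ≤ kerBelow G n j := by
  refine (Subgroup.closure_le _).2 ?_
  rintro _ ⟨a, α, x, h1, -, h3, h4, rfl⟩ m f i hi hf
  have key := surjection_val_eq h1 h3
  have hle : ∀ s : Fin (n + 1), j ≤ (s : ℕ) → j ≤ (α.toOrderHom s : ℕ) := fun s hs => by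
    have h5 := key ⟨j, by omega⟩ le_rfl
    have h6 : (α.toOrderHom (⟨j, by omega⟩ : Fin (n + 1)) : ℕ) ≤ α.toOrderHom s :=
      α.toOrderHom.monotone (Fin.le_def.2 hs)
    simp only at h5
    omega
  rw [← pull_comp]
  refine pull_eq_one_of_mem_moore G h4 _ i ?_ fun t h => ?_
  · have h5 := hle ⟨n, by omega⟩ hj
    have h6 : (α.toOrderHom (⟨n, by omega⟩ : Fin (n + 1)) : ℕ) < a + 1 := Fin.is_lt _
    omega
  · rw [comp_val] at h
    rcases Nat.lt_or_ge (f.toOrderHom t) j with h' | h'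
    · rw [key _ h'.le] at h
      exact hf t h
    · have := hle _ h'
      omega

/-- Composing α with σ_i makes i an index, whence nonemptiness, and creates no index below j because
j ≤ i. -/
theorem sigma_mem_degenFrom {n j : ℕ} (i : Fin (n + 1)) (hij : j ≤ (i : ℕ)) {z : G _⦋n⦌}
    (hz : z ∈ genFrom G n j) : pull G (SimplexCategory.σ i) z ∈ degenFrom G (n + 1) j := by
  have : genFrom G n j ≤ (degenFrom G (n + 1) j).comap (pull G (SimplexCategory.σ i)) := by
    refine (Subgroup.closure_le _).2 ?_
    rintro _ ⟨a, α, x, h1, h2, h3, rfl⟩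
    refine Subgroup.subset_closure ⟨a, SimplexCategory.σ i ≫ α, x, ?_, ⟨i, ?_⟩, ?_, h3,
      pull_comp G _ _ _⟩
    · intro s
      obtain ⟨t, rfl⟩ := h1 s
      refine ⟨i.castSucc.succAbove t, ?_⟩
      rw [comp_val]
      exact congrArg _ (Fin.ext (by
        rw [sigma_val]
        simp only [Fin.succAbove, Fin.lt_def, Fin.val_castSucc]
        split_ifs <;> simp_all <;> omega))
    · refine Finset.mem_filter.2 ⟨Finset.mem_univ _, ?_⟩
      rw [comp_val, comp_val]
      exact congrArg _ (Fin.ext (by rw [sigma_val, sigma_val]; simp))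
    · intro l hl
      by_contra hlj
      have hl' := (Finset.mem_filter.1 hl).2
      rw [comp_val, comp_val] at hl'
      have hln : (l : ℕ) < n := by omega
      have e1 : (SimplexCategory.σ i).toOrderHom l.castSucc = (⟨l, hln⟩ : Fin n).castSucc :=
        Fin.ext (by
          rw [sigma_val]
          simp only [Fin.val_castSucc]
          rw [if_pos (by omega)])
      have e2 : (SimplexCategory.σ i).toOrderHom l.succ = (⟨l, hln⟩ : Fin n).succ :=
        Fin.ext (by
          rw [sigma_val]
          simp only [Fin.val_succ]
          rw [if_pos (by omega)])
      rw [e1, e2] at hl'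
      have := h2 _ (Finset.mem_filter.2 ⟨Finset.mem_univ _, hl'⟩)
      simp only at this
      omega
  exact this hz

/-- The k-th step contributes the factor s_k d_k w. For k < j it is trivial, since w still lies in
`kerBelow j`. For k ≥ j, w is killed by d_0, …, d_{k-1}, hence so is d_k w, and `hgen` one dimension
lower writes d_k w through indices ≥ k. -/
theorem projUpTo_inv_mul_mem_degenFrom {n j : ℕ} (hj : j ≤ n + 1)
    (hgen : ∀ k ≤ n, kerBelow G n k ≤ genFrom G n k) {z : G _⦋n + 1⦌}
    (hz : z ∈ kerBelow G (n + 1) j) (k : ℕ) (hk : k ≤ n + 1) :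
    (projUpTo G n k hk z)⁻¹ * z ∈ degenFrom G (n + 1) j := by
  induction k with
  | zero => simp [projUpTo, one_mem]
  | succ k ih =>
    have h := ih (Nat.le_of_succ_le hk)
    have hmem := projUpTo_mem G n k (Nat.le_of_succ_le hk) z
    rw [projUpTo, projStep, mul_inv_rev, inv_inv, mul_assoc]
    set w := projUpTo G n k (Nat.le_of_succ_le hk) z
    refine mul_mem ?_ h
    rw [sigma_eq_pull, delta_eq_pull]
    rcases Nat.lt_or_ge k j with hkj | hkj
    · have hw : w ∈ kerBelow G (n + 1) j := by
        have h1 := mul_mem hz (inv_mem (degenFrom_le_kerBelow G hj h))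
        rwa [mul_inv_rev, inv_inv, mul_inv_cancel_left] at h1
      rw [hw n _ k hkj, map_one]
      · exact one_mem _
      · intro t
        rw [delta_val]
        simp only [Fin.val_castSucc]
        split_ifs <;> omega
    · refine degenFrom_anti G _ hkj (sigma_mem_degenFrom G ⟨k, hk⟩ le_rfl (hgen k (by omega) ?_))
      intro m f i hi hf
      have hw : w ∈ kerBelow G (n + 1) k :=
        mem_kerBelow_of G (fun i hi => hmem ⟨i, by omega⟩ hi) (by omega)
      rw [← pull_comp]
      refine hw m _ i hi fun t => ?_
      have := hf t
      rw [comp_val, delta_val]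
      simp only [Fin.val_castSucc]
      split_ifs <;> omega

/-- By induction on n, z is p(z) times an element of `degenFrom j`, and p(z) is itself a generator,
with α the identity. For j = 0 this says that G_n is generated by the s_α x with x in the Moore
complex. -/
theorem kerBelow_le_genFrom (n : ℕ) : ∀ j ≤ n, kerBelow G n j ≤ genFrom G n j := by
  induction n with
  | zero =>
    intro j _ z _
    exact Subgroup.subset_closure ⟨0, 𝟙 _, z, fun t => ⟨t, rfl⟩, fun i => i.elim0, trivial,
      pull_id G z⟩
  | succ n ih =>
    intro j hj z hz
    have h := degenFrom_le_genFrom G _ _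
      (projUpTo_inv_mul_mem_degenFrom G hj ih hz (n + 1) le_rfl)
    refine (Subgroup.mul_mem_cancel_left _ (inv_mem ?_)).1 h
    refine Subgroup.subset_closure ⟨n + 1, 𝟙 _, _, fun t => ⟨t, rfl⟩, fun i hi => ?_,
      (mooreProj G (n + 1) z).2, pull_id G _⟩
    have h1 : i.castSucc = i.succ := (Finset.mem_filter.1 hi).2
    have h2 := congrArg Fin.val h1
    simp at h2

theorem mem_degenFrom_of_mooreProj_eq_one {n j : ℕ} (hj : j ≤ n + 1) {z : G _⦋n + 1⦌}
    (hz : z ∈ kerBelow G (n + 1) j) (h : mooreProj G (n + 1) z = 1) :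
    z ∈ degenFrom G (n + 1) j := by
  have h1 := projUpTo_inv_mul_mem_degenFrom G hj (kerBelow_le_genFrom G n) hz (n + 1) le_rfl
  have h2 : projUpTo G n (n + 1) le_rfl z = 1 := congrArg Subtype.val h
  rwa [h2, inv_one, one_mul] at h1

theorem degen_le_degenFrom (n : ℕ) : degen G (n + 1) ≤ degenFrom G (n + 1) 0 := fun _ hz =>
  degen_induction G (p := (· ∈ degenFrom G (n + 1) 0)) hz
    (fun i _ => sigma_mem_degenFrom G i (Nat.zero_le _)
      (kerBelow_le_genFrom G n 0 (Nat.zero_le _) fun _ _ i hi => absurd hi (Nat.not_lt_zero i)))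
    (one_mem _) (fun _ _ => mul_mem) (fun _ => inv_mem)

/-! ### Vanishing Peiffer pairings -/

/-- All Peiffer pairings of `G` are trivial. -/
def PeifferTrivial : Prop :=
  ∀ (n a b : ℕ) (α : ⦋n⦌ ⟶ ⦋a⦌) (β : ⦋n⦌ ⟶ ⦋b⦌), IsPeifferPair α β →
    ∀ (x : moore G a) (y : moore G b), peifferPairing G α β x y = 1

variable {G}

/-- The only place where the pairings enter. The commutator lies in the normal subgroup `kerBelow (j
+ 1)` because s_β y does; if its projection is trivial, it is a product of degenerate elements with
indices ≥ j+1. -/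
theorem commutator_mem_degenFrom (hF : PeifferTrivial G) {n a b : ℕ} {j : Fin (n + 1)}
    {α : ⦋n + 1⦌ ⟶ ⦋a⦌} {β : ⦋n + 1⦌ ⟶ ⦋b⦌} (hα : Function.Surjective α.toOrderHom)
    (hβ : Function.Surjective β.toOrderHom) (hjα : j ∈ indexSet α)
    (hβ' : (indexSet β).Nonempty)
    (hjβ : ∀ i ∈ indexSet β, (j : ℕ) + 1 ≤ (i : ℕ)) {x : G _⦋a⦌} {y : G _⦋b⦌}
    (hx : x ∈ moore G a) (hy : y ∈ moore G b) :
    ⁅pull G α x, pull G β y⁆ ∈ degenFrom G (n + 1) (j + 1) := by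
  have hb : pull G β y ∈ kerBelow G (n + 1) (j + 1) :=
    degenFrom_le_kerBelow G (by omega) (Subgroup.subset_closure ⟨b, β, y, hβ, hβ', hjβ, hy, rfl⟩)
  have hK : ⁅pull G α x, pull G β y⁆ ∈ kerBelow G (n + 1) (j + 1) :=
    mul_mem ((kerBelow_normal G _ _).conj_mem _ hb _) (inv_mem hb)
  by_cases hd : Disjoint (indexSet α) (indexSet β)
  · refine mem_degenFrom_of_mooreProj_eq_one G (by omega) hK ?_
    exact hF _ _ _ α β ⟨hα, hβ, ⟨j, hjα⟩, hβ', hd, indexLT_of_lt hjα hβ' fun i hi => hjβ i hi⟩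
      ⟨x, hx⟩ ⟨y, hy⟩
  -- With a common index i no pairing is available, but the commutator is then s_i of a commutator
  -- one dimension lower. As i ≥ j+1, applying d_i shows that the latter is still in `kerBelow (j +
  -- 1)`.
  · obtain ⟨i, hiα, hiβ⟩ := Finset.not_disjoint_iff.1 hd
    obtain ⟨α', rfl⟩ := SimplexCategory.eq_σ_comp_of_not_injective' α i (Finset.mem_filter.1 hiα).2
    obtain ⟨β', rfl⟩ := SimplexCategory.eq_σ_comp_of_not_injective' β i (Finset.mem_filter.1 hiβ).2
    have hij := hjβ i hiβ
    rw [pull_comp, pull_comp, ← map_commutatorElement] at hK ⊢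
    refine sigma_mem_degenFrom G i hij (kerBelow_le_genFrom G n _ (by omega) ?_)
    intro m f l hl hf
    have h := hK m (f ≫ SimplexCategory.δ i.castSucc) l hl fun t => by
      have := hf t
      rw [comp_val, delta_val]
      simp only [Fin.val_castSucc]
      split_ifs <;> omega
    rwa [← pull_comp, Category.assoc, SimplexCategory.δ_comp_σ_self, Category.comp_id] at h

theorem conj_mem_degenFrom (hF : PeifferTrivial G) {n a : ℕ} {j : Fin (n + 1)}
    {α : ⦋n + 1⦌ ⟶ ⦋a⦌} (hα : Function.Surjective α.toOrderHom) (hjα : j ∈ indexSet α)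
    {x : G _⦋a⦌} (hx : x ∈ moore G a) {z : G _⦋n + 1⦌} (hz : z ∈ degenFrom G (n + 1) (j + 1)) :
    pull G α x * z * (pull G α x)⁻¹ ∈ degenFrom G (n + 1) (j + 1) := by
  have : degenFrom G (n + 1) (j + 1) ≤
      (degenFrom G (n + 1) (j + 1)).comap (MulAut.conj (pull G α x)).toMonoidHom := by
    refine (Subgroup.closure_le _).2 ?_
    rintro _ ⟨b, β, y, h1, h2, h3, h4, rfl⟩
    have h5 := mul_mem (commutator_mem_degenFrom hF hα h1 hjα h2 h3 hx h4)
      (Subgroup.subset_closure ⟨b, β, y, h1, h2, h3, h4, rfl⟩)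
    rw [commutatorElement_def, inv_mul_cancel_right] at h5
    exact h5
  exact this hz

/-- An element of `degenFrom j` is the product of one of `degenFrom (j + 1)` and of an element in
the image of `s_j`. -/
theorem exists_eq_mul_sigma (hF : PeifferTrivial G) {n : ℕ} (j : Fin (n + 1)) {z : G _⦋n + 1⦌}
    (hz : z ∈ degenFrom G (n + 1) j) :
    ∃ w ∈ degenFrom G (n + 1) (j + 1), ∃ y, z = w * pull G (SimplexCategory.σ j) y := by
  -- Strengthened so that s_j y and its inverse normalise `degenFrom (j + 1)`; products and inverses
  -- can then be rearranged in the closure induction.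
  suffices H : ∃ w ∈ degenFrom G (n + 1) (j + 1), ∃ y,
      (∀ v ∈ degenFrom G (n + 1) (j + 1), pull G (SimplexCategory.σ j) y * v *
        (pull G (SimplexCategory.σ j) y)⁻¹ ∈ degenFrom G (n + 1) (j + 1)) ∧
      (∀ v ∈ degenFrom G (n + 1) (j + 1), (pull G (SimplexCategory.σ j) y)⁻¹ * v *
        pull G (SimplexCategory.σ j) y ∈ degenFrom G (n + 1) (j + 1)) ∧
      z = w * pull G (SimplexCategory.σ j) y by
    obtain ⟨w, hw, y, -, -, h⟩ := H
    exact ⟨w, hw, y, h⟩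
  refine Subgroup.closure_induction ?_ ?_ ?_ ?_ hz
  · rintro _ ⟨a, α, x, h1, h2, h3, h4, rfl⟩
    by_cases hj : j ∈ indexSet α
    · have c1 := fun v hv => conj_mem_degenFrom hF h1 hj h4 (z := v) hv
      have c2 := fun v hv => conj_mem_degenFrom hF h1 hj (inv_mem h4) (z := v) hv
      obtain ⟨α', rfl⟩ :=
        SimplexCategory.eq_σ_comp_of_not_injective' α j (Finset.mem_filter.1 hj).2
      refine ⟨1, one_mem _, pull G α' x, ?_, ?_, by rw [one_mul, pull_comp]⟩
      · simpa only [pull_comp] using c1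
      · simpa only [pull_comp, map_inv, inv_inv] using c2
    · refine ⟨pull G α x, Subgroup.subset_closure ⟨a, α, x, h1, h2, fun i hi => ?_, h4, rfl⟩,
        1, ?_, ?_, by simp⟩
      · have := h3 i hi
        have : (i : ℕ) ≠ j := fun h => hj (Fin.ext h ▸ hi)
        omega
      all_goals simp
  · exact ⟨1, one_mem _, 1, by simp, by simp, by simp⟩
  · rintro _ _ _ _ ⟨w, hw, y, h1, h2, rfl⟩ ⟨w', hw', y', h1', h2', rfl⟩
    refine ⟨w * (pull G (SimplexCategory.σ j) y * w' * (pull G (SimplexCategory.σ j) y)⁻¹),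
      mul_mem hw (h1 _ hw'), y * y', fun v hv => ?_, fun v hv => ?_, ?_⟩
    · have := h1 _ (h1' v hv)
      rw [map_mul]
      simpa only [mul_assoc, mul_inv_rev] using this
    · have := h2' _ (h2 v hv)
      rw [map_mul]
      simpa only [mul_assoc, mul_inv_rev] using this
    · rw [map_mul]; group
  · rintro _ _ ⟨w, hw, y, h1, h2, rfl⟩
    refine ⟨_, h2 _ (inv_mem hw), y⁻¹, fun v hv => ?_, fun v hv => ?_, ?_⟩
    · rw [map_inv, inv_inv]
      exact h2 v hv
    · rw [map_inv, inv_inv]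
      exact h1 v hv
    · rw [map_inv]; group

/-- Descent along the filtration: writing z = w · s_j y, the face d_j kills z and w, hence y = d_j
s_j y = 1 and z = w. At j = n+1 no index is left, so the subgroup is trivial. -/
theorem eq_one_of_mem_degenFrom (hF : PeifferTrivial G) {n : ℕ} {z : G _⦋n + 1⦌}
    (hz : z ∈ moore G (n + 1)) (k j : ℕ) (hkj : j + k = n + 1)
    (hz' : z ∈ degenFrom G (n + 1) j) : z = 1 := by
  induction k generalizing j with
  | zero =>
    refine (Subgroup.mem_bot).1 (((Subgroup.closure_le ⊥).2 ?_) hz')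
    rintro _ ⟨a, α, x, -, ⟨i, hi⟩, h3, -, -⟩
    have := h3 i hi
    omega
  | succ k ih =>
    obtain ⟨w, hw, y, hzw⟩ := exists_eq_mul_sigma hF ⟨j, by omega⟩ hz'
    have h1 := degenFrom_le_kerBelow G (by simp only; omega) hw n
      (SimplexCategory.δ (Fin.castSucc ⟨j, by omega⟩)) j (by simp) (fun t => by
        rw [delta_val]
        simp only [Fin.val_castSucc]
        split_ifs <;> omega)
    have h2 := (mem_moore_succ G).1 hz ⟨j, by omega⟩
    rw [delta_eq_pull, hzw, map_mul, h1, one_mul, ← pull_comp, SimplexCategory.δ_comp_σ_self,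
      pull_id] at h2
    refine ih (j + 1) (by omega) ?_
    rwa [hzw, h2, map_one, mul_one]

/-- If the Peiffer pairings vanish, the Moore complex meets the degenerate elements trivially. -/
theorem mooreDegenTrivial_of_peifferTrivial (hF : PeifferTrivial G) : MooreDegenTrivial G := by
  intro n z hz hz'
  cases n with
  | zero => exact degen_zero G hz'
  | succ n =>
    exact eq_one_of_mem_degenFrom hF hz (n + 1) 0 (by omega) (degen_le_degenFrom G n hz')

end SimplicialGroup

namespace SimplicialGroup

variable {G : SimplicialObject GrpCat.{u}}

/-! ### Faces of degenerate elements -/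

theorem pull_delta_sigma_castSucc {n : ℕ} (i : Fin (n + 1)) (z : G _⦋n⦌) :
    pull G (SimplexCategory.δ i.castSucc) (pull G (SimplexCategory.σ i) z) = z := by
  rw [← pull_comp, SimplexCategory.δ_comp_σ_self, pull_id]

theorem pull_delta_sigma_succ {n : ℕ} (i : Fin (n + 1)) (z : G _⦋n⦌) :
    pull G (SimplexCategory.δ i.succ) (pull G (SimplexCategory.σ i) z) = z := by
  rw [← pull_comp, SimplexCategory.δ_comp_σ_succ, pull_id]

theorem pull_delta_sigma_of_mem_moore {n : ℕ} {y : G _⦋n⦌} (hy : y ∈ moore G n) (i : Fin (n + 1))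
    (j : Fin (n + 2)) (h1 : (j : ℕ) ≠ i) (h2 : (j : ℕ) ≠ i + 1) (h3 : (j : ℕ) ≤ n) :
    pull G (SimplexCategory.δ j) (pull G (SimplexCategory.σ i) y) = 1 := by
  rw [← pull_comp]
  -- The omitted vertex is σ_i(j), whose only preimage under σ_i is j because j is neither i nor
  -- i+1.
  refine pull_eq_one_of_mem_moore G hy _ (if (j : ℕ) < i then j else j - 1) ?_ fun t => ?_
  · split_ifs <;> omega
  · rw [comp_val, sigma_val, delta_val]
    split_ifs <;> omega

theorem delta_sigma_not_injective {n : ℕ} (i : Fin (n + 3)) (j : Fin (n + 2)) (h1 : (i : ℕ) ≠ j)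
    (h2 : (i : ℕ) ≠ j + 1) :
    ¬ Function.Injective (SimplexCategory.δ i ≫ SimplexCategory.σ j).toOrderHom := fun h => by
  -- These are the preimages under δ_i of j and j+1, which σ_j identifies.
  have h3 : (⟨if (j : ℕ) < i then j else j - 1, by split_ifs <;> omega⟩ : Fin (n + 2)) =
      ⟨if (j : ℕ) < i then j + 1 else j, by split_ifs <;> omega⟩ := h (Fin.ext (by
    rw [comp_val, comp_val, sigma_val, sigma_val, delta_val, delta_val]
    simp only
    split_ifs <;> omega))
  have := congrArg Fin.val h3
  simp only at this
  split_ifs at this <;> omega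

theorem pull_delta_sigma_mem_degen {n : ℕ} (i : Fin (n + 3)) (j : Fin (n + 2)) (h1 : (i : ℕ) ≠ j)
    (h2 : (i : ℕ) ≠ j + 1) (y : G _⦋n + 1⦌) :
    pull G (SimplexCategory.δ i) (pull G (SimplexCategory.σ j) y) ∈ degen G (n + 1) := by
  rw [← pull_comp]
  exact pull_mem_degen G _ (delta_sigma_not_injective i j h1 h2) y

/-! ### Commutation in a simplicial group whose Moore complex has no degenerate elements -/

/-- The commutator is a product of degenerate elements killed by every face but the last, so it lies
in NG ∩ D = 1. -/
theorem commute_of_faces (hT : MooreDegenTrivial G) {n : ℕ} {b v : G _⦋n + 1⦌}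
    (hb : b ∈ degen G (n + 1)) (hv : v ∈ degen G (n + 1))
    (h : ∀ i : Fin (n + 1), pull G (SimplexCategory.δ i.castSucc) b = 1 ∨
      pull G (SimplexCategory.δ i.castSucc) v = 1) : Commute b v := by
  rw [← commutatorElement_eq_one_iff_commute]
  refine hT _ _ (mem_moore_of G fun i => ?_)
    (mul_mem (mul_mem (mul_mem hb hv) (inv_mem hb)) (inv_mem hv))
  rw [map_commutatorElement]
  rcases h i with h | h <;> simp [h]

/-- A degenerate element with one nontrivial face besides the last one, which is `y` up to
degenerate elements. -/
theorem exists_thin_filler {n : ℕ} {y : G _⦋n + 1⦌} (hy : y ∈ moore G (n + 1)) (k i : ℕ)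
    (hik : i + k = n + 1) :
    ∃ b ∈ degen G (n + 2),
      (∀ j : Fin (n + 3), (j : ℕ) ≠ i → (j : ℕ) ≤ n + 1 → pull G (SimplexCategory.δ j) b = 1) ∧
      (∀ j : Fin (n + 3), (j : ℕ) = i → pull G (SimplexCategory.δ j) b = y ∨
        pull G (SimplexCategory.δ j) b = y⁻¹) ∧
      y⁻¹ * pull G (SimplexCategory.δ (Fin.last (n + 2))) b ∈ degen G (n + 1) := by
  induction k generalizing i with
  | zero =>
    -- The faces d_{n+1} and d_{n+2} of s_{n+1} y equal y; the others are trivial.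
    refine ⟨pull G (SimplexCategory.σ (Fin.last (n + 1))) y, sigma_mem_degen G _ _, ?_, ?_, ?_⟩
    · intro j h1 h2
      exact pull_delta_sigma_of_mem_moore hy _ _ (by simp; omega) (by simp; omega) h2
    · intro j h
      obtain rfl : j = (Fin.last (n + 1)).castSucc := Fin.ext (by simp; omega)
      exact Or.inl (pull_delta_sigma_castSucc _ _)
    · rw [← Fin.succ_last, pull_delta_sigma_succ, inv_mul_cancel]
      exact one_mem _
  | succ k ih =>
    have hi : i < n + 2 := by omega
    obtain ⟨b, hb, h1, h2, h3⟩ := ih (i + 1) (by omega)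
    -- Multiplying by s_i c, with c inverse to the face d_{i+1} b, moves the nontrivial face from
    -- i+1 to i. Since i ≤ n, the last face changes only by a degenerate factor.
    obtain ⟨c, hc, hcy, hcb⟩ : ∃ c ∈ moore G (n + 1), (c = y ∨ c = y⁻¹) ∧
        pull G (SimplexCategory.δ ⟨i + 1, by omega⟩) b * c = 1 := by
      rcases h2 ⟨i + 1, by omega⟩ rfl with h | h
      · exact ⟨y⁻¹, inv_mem hy, Or.inr rfl, by rw [h, mul_inv_cancel]⟩
      · exact ⟨y, hy, Or.inl rfl, by rw [h, inv_mul_cancel]⟩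
    refine ⟨b * pull G (SimplexCategory.σ ⟨i, hi⟩) c, mul_mem hb (sigma_mem_degen G _ _),
      ?_, ?_, ?_⟩
    · intro j hj hj'
      rw [map_mul]
      rcases eq_or_ne (j : ℕ) (i + 1) with h | h
      · obtain rfl : j = Fin.succ ⟨i, hi⟩ := Fin.ext h
        rw [pull_delta_sigma_succ]
        exact hcb
      · rw [h1 j h hj', one_mul]
        exact pull_delta_sigma_of_mem_moore hc _ _ hj h hj'
    · intro j hj
      obtain rfl : j = Fin.castSucc ⟨i, hi⟩ := Fin.ext hj
      rw [map_mul, h1 _ (by simp) (by simp; omega), one_mul, pull_delta_sigma_castSucc]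
      exact hcy
    · rw [map_mul, ← mul_assoc]
      exact mul_mem h3 (pull_delta_sigma_mem_degen _ _ (by simp only [Fin.val_last]; omega)
        (by simp only [Fin.val_last]; omega) _)

/-- A degenerate element with a trivial face other than the last one centralises the Moore
complex. -/
theorem commute_of_face_eq_one (hT : MooreDegenTrivial G) {n : ℕ} {v y : G _⦋n + 1⦌}
    (hv : v ∈ degen G (n + 1)) (i : Fin (n + 1))
    (hi : pull G (SimplexCategory.δ i.castSucc) v = 1) (hy : y ∈ moore G (n + 1)) :
    Commute y v := by
  obtain ⟨b, hb, h1, -, h3⟩ := exists_thin_filler hy (n + 1 - i) i (by omega)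
  -- The face d_i kills s_{n+1} v because it kills v; the other faces except the last kill b.
  -- Applying the last face then shows that d_{n+2} b commutes with v.
  have c1 : Commute b (pull G (SimplexCategory.σ (Fin.last (n + 1))) v) := by
    refine commute_of_faces hT hb (sigma_mem_degen G _ _) fun j => ?_
    rcases eq_or_ne (j : ℕ) i with h | h
    · right
      obtain rfl : j = i.castSucc := Fin.ext h
      rw [← pull_comp, ← Fin.succ_last,
        SimplexCategory.δ_comp_σ_of_le (by simp [Fin.le_def]; omega), pull_comp, hi, map_one]
    · exact Or.inl (h1 _ h (by simp; omega))
  have c2 := c1.map (pull G (SimplexCategory.δ (Fin.last (n + 2))))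
  rw [← Fin.succ_last, pull_delta_sigma_succ] at c2
  -- The discrepancy between d_{n+2} b and y is degenerate and, except for d_i and the last face,
  -- all its faces are trivial; d_i kills v.
  have c3 : Commute (y⁻¹ * pull G (SimplexCategory.δ (Fin.last (n + 2))) b) v := by
    refine commute_of_faces hT h3 hv fun j => ?_
    rcases eq_or_ne j i with h | h
    · exact Or.inr (h ▸ hi)
    · left
      have e : pull G (SimplexCategory.δ j.castSucc)
          (pull G (SimplexCategory.δ (Fin.last (n + 2))) b) = 1 := by
        rw [← pull_comp, ← Fin.succ_last, SimplexCategory.δ_comp_δ (Fin.le_last _), pull_comp,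
          h1 _ (by simpa [Fin.ext_iff] using h) (by simp), map_one]
      rw [map_mul, e, map_inv, show pull G (SimplexCategory.δ j.castSucc) y = 1 from
        (mem_moore_succ G).1 hy j]
      simp
  have := c2.mul_left c3.inv_left
  rwa [Fin.succ_last, mul_inv_rev, inv_inv, mul_inv_cancel_left] at this

/-- The monotone map fixing the vertices below `j` and sending the others to the last vertex. -/
def collapse (n j : ℕ) : ⦋n⦌ ⟶ ⦋n⦌ :=
  SimplexCategory.mkHom
    { toFun := fun t => if (t : ℕ) < j then t else Fin.last n
      monotone' := fun s t h => by
        have h' : (s : ℕ) ≤ t := h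
        simp only
        split_ifs
        · exact h
        · exact Fin.le_last _
        · omega
        · exact le_rfl }

theorem collapse_val (n j : ℕ) (t : Fin (n + 1)) :
    ((collapse n j).toOrderHom t : ℕ) = if (t : ℕ) < j then (t : ℕ) else n := by
  change ((if (t : ℕ) < j then t else Fin.last n : Fin (n + 1)) : ℕ) = _
  split_ifs <;> simp

/-- A degenerate element acts on the Moore complex through its last vertex. -/
theorem commute_lastVertex_inv_mul (hT : MooreDegenTrivial G) {n : ℕ} {z y : G _⦋n⦌}
    (hz : z ∈ degen G n) (hy : y ∈ moore G n) :
    Commute y ((pull G (SimplexCategory.const ⦋n⦌ ⦋n⦌ (Fin.last n)) z)⁻¹ * z) := by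
  cases n with
  | zero =>
    rw [degen_zero G hz]
    simp
  | succ n =>
    have key : ∀ k j : ℕ, j + k = n + 1 → pull G (collapse (n + 1) j) z ∈ degen G (n + 1) ∧
        Commute y ((pull G (collapse (n + 1) j) z)⁻¹ * z) := by
      intro k
      induction k with
      | zero =>
        intro j hj
        have : collapse (n + 1) j = 𝟙 _ := hom_ext_val fun t => by
          rw [collapse_val]
          change _ = (t : ℕ)
          split_ifs <;> omega
        rw [this, pull_id]
        exact ⟨hz, by simp⟩
      | succ k ih =>
        intro j hj
        obtain ⟨h1, h2⟩ := ih (j + 1) (by omega)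
        -- Collapsing one more vertex replaces w by s_j d_j w, and (s_j d_j w)⁻¹ w is a degenerate
        -- element killed by d_j, so it commutes with y. The collapses run from the identity (j =
        -- n+1) to the constant map at the last vertex (j = 0).
        have e : collapse (n + 1) j = SimplexCategory.σ ⟨j, by omega⟩ ≫
            SimplexCategory.δ (Fin.castSucc ⟨j, by omega⟩) ≫ collapse (n + 1) (j + 1) :=
          hom_ext_val fun t => by
            rw [comp_val, comp_val, collapse_val, collapse_val, delta_val, sigma_val]
            simp only [Fin.val_castSucc]
            split_ifs <;> omega
        rw [e, pull_comp, pull_comp]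
        set w := pull G (collapse (n + 1) (j + 1)) z
        refine ⟨sigma_mem_degen G _ _, ?_⟩
        have c := commute_of_face_eq_one hT (mul_mem (inv_mem (sigma_mem_degen G
          ⟨j, by omega⟩ (pull G (SimplexCategory.δ (Fin.castSucc ⟨j, by omega⟩)) w))) h1)
          ⟨j, by omega⟩ (by rw [map_mul, map_inv, pull_delta_sigma_castSucc, inv_mul_cancel]) hy
        have := c.mul_right h2
        rwa [mul_assoc, mul_inv_cancel_left] at this
    have h := (key (n + 1) 0 (by omega)).2
    have e : collapse (n + 1) 0 = SimplexCategory.const _ _ (Fin.last (n + 1)) :=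
      hom_ext_val fun t => by
        rw [collapse_val]
        simp
    rwa [e] at h

/-- An element `x` of `G_{n+1}` acts on the Moore complex as `s_n d_{n+1} x`. -/
theorem commute_sigma_delta_last (hT : MooreDegenTrivial G) {n : ℕ} (x : G _⦋n + 1⦌)
    {y : G _⦋n + 1⦌} (hy : y ∈ moore G (n + 1)) :
    Commute y (pull G (SimplexCategory.σ (Fin.last n))
      (pull G (SimplexCategory.δ (Fin.last (n + 1))) x) * x⁻¹) := by
  -- Among the faces other than the last, only d_{n+1} is nontrivial on s_{n+1} y, and it kills s_n
  -- x (s_{n+1} x)⁻¹. The last face d_{n+2} of this relation is the claim.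
  have c : Commute (pull G (SimplexCategory.σ (Fin.last (n + 1))) y)
      (pull G (SimplexCategory.σ (Fin.last n).castSucc) x *
        (pull G (SimplexCategory.σ (Fin.last (n + 1))) x)⁻¹) := by
    refine commute_of_faces hT (sigma_mem_degen G _ _)
      (mul_mem (sigma_mem_degen G _ _) (inv_mem (sigma_mem_degen G _ _))) fun i => ?_
    rcases eq_or_ne i (Fin.last (n + 1)) with rfl | h
    · right
      rw [map_mul, map_inv, pull_delta_sigma_castSucc]
      have := pull_delta_sigma_succ (Fin.last n).castSucc x
      rw [Fin.succ_castSucc, Fin.succ_last] at this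
      rw [this, mul_inv_cancel]
    · left
      have h' : (i : ℕ) ≠ n + 1 := fun h' => h (Fin.ext h')
      exact pull_delta_sigma_of_mem_moore hy _ _ (by simpa using h') (by simp; omega)
        (by simp; omega)
  have c2 := c.map (pull G (SimplexCategory.δ (Fin.last (n + 1)).succ))
  rw [map_mul, map_inv, pull_delta_sigma_succ, pull_delta_sigma_succ, ← pull_comp,
    SimplexCategory.δ_comp_σ_of_gt (by simp [Fin.lt_def]), pull_comp] at c2
  exact c2

/-! ### Crossed complex axioms for the Moore complex -/

theorem pull_const_eq_one {n m : ℕ} {z : G _⦋n + 1⦌} (hz : z ∈ moore G (n + 1)) (i : Fin (n + 2))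
    (hi : i ≠ 0) : pull G (SimplexCategory.const ⦋m⦌ ⦋n + 1⦌ i) z = 1 :=
  pull_eq_one_of_mem_moore G hz _ 0 (by omega) fun _ h => hi (Fin.ext h)

/-- The element x acts as s_{n+1} d_{n+2} x, which is degenerate and hence acts through its last
vertex. That is the vertex n+1 of x, trivial since n+1 ≠ 0. In degree 1 it would be the vertex 0,
and only the Peiffer identity remains. -/
theorem moore_commute (hT : MooreDegenTrivial G) {n : ℕ} {x y : G _⦋n + 2⦌}
    (hx : x ∈ moore G (n + 2)) (hy : y ∈ moore G (n + 2)) : Commute x y := by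
  have c1 := commute_sigma_delta_last hT x hy
  have c2 := commute_lastVertex_inv_mul hT (sigma_mem_degen G (Fin.last (n + 1))
    (pull G (SimplexCategory.δ (Fin.last (n + 2))) x)) hy
  have e : pull G (SimplexCategory.const ⦋n + 2⦌ ⦋n + 2⦌ (Fin.last (n + 2)))
      (pull G (SimplexCategory.σ (Fin.last (n + 1)))
        (pull G (SimplexCategory.δ (Fin.last (n + 2))) x)) = 1 := by
    rw [← pull_comp, ← pull_comp]
    refine pull_eq_one_of_mem_moore G hx _ 0 (by omega) fun t => ?_
    rw [comp_val, comp_val, delta_val, sigma_val]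
    simp
  rw [e, inv_one, one_mul] at c2
  have := c1.inv_right.mul_right c2
  rw [mul_inv_rev, inv_inv, mul_assoc, inv_mul_cancel, mul_one] at this
  exact this.symm

/-- Let χ send only the last vertex to 1. The degenerate element χ^* m acts through its last vertex,
the vertex 1 of m, hence trivially; it also acts as the last degeneracy of its last face, which is
the total degeneracy of d_1 m. -/
theorem totalDegeneracy_boundary_commute (hT : MooreDegenTrivial G) {n : ℕ} {m : G _⦋1⦌}
    {y : G _⦋n + 2⦌} (hm : m ∈ moore G 1) (hy : y ∈ moore G (n + 2)) :
    Commute y (pull G (SimplexCategory.const ⦋n + 2⦌ ⦋0⦌ 0)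
      (pull G (SimplexCategory.δ (Fin.last 1)) m)) := by
  let χ : ⦋n + 2⦌ ⟶ ⦋1⦌ := SimplexCategory.mkHom
    { toFun := fun t => if (t : ℕ) = n + 2 then 1 else 0
      monotone' := fun s t h => by
        have h' : (s : ℕ) ≤ t := h
        have := t.is_lt
        simp only
        split_ifs
        · exact le_rfl
        · omega
        · exact Fin.zero_le _
        · exact le_rfl }
  have χval : ∀ t : Fin (n + 3), (χ.toOrderHom t : ℕ) = if (t : ℕ) = n + 2 then 1 else 0 :=
      fun t => by
    change ((if (t : ℕ) = n + 2 then 1 else 0 : Fin 2) : ℕ) = _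
    split_ifs <;> simp
  have hχ : ¬ Function.Injective χ.toOrderHom := fun h => by
    have h1 : (⟨0, by omega⟩ : Fin (n + 3)) = ⟨1, by omega⟩ := h (Fin.ext (by
      rw [χval, χval]
      simp))
    simp at h1
  have c1 := commute_lastVertex_inv_mul hT (pull_mem_degen G χ hχ m) hy
  have c2 := commute_sigma_delta_last hT (pull G χ m) hy
  rw [← pull_comp, pull_eq_one_of_mem_moore G hm _ 0 (by omega) (fun t => by
    rw [comp_val, χval]
    simp), inv_one, one_mul] at c1
  have := c2.mul_right c1
  rw [inv_mul_cancel_right, ← pull_comp, ← pull_comp] at this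
  rw [← pull_comp]
  have e : SimplexCategory.const ⦋n + 2⦌ ⦋0⦌ 0 ≫ SimplexCategory.δ (Fin.last 1) =
      SimplexCategory.σ (Fin.last (n + 1)) ≫ SimplexCategory.δ (Fin.last (n + 2)) ≫ χ :=
    hom_ext_val fun t => by
      rw [comp_val, comp_val, comp_val, χval, delta_val, delta_val, sigma_val]
      simp
      split_ifs <;> omega
  rwa [e]

theorem moore_one_peiffer (hT : MooreDegenTrivial G) {m m' : G _⦋1⦌} (hm' : m' ∈ moore G 1) :
    pull G (SimplexCategory.const ⦋1⦌ ⦋0⦌ 0) (pull G (SimplexCategory.δ (Fin.last 1)) m) * m' *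
      (pull G (SimplexCategory.const ⦋1⦌ ⦋0⦌ 0) (pull G (SimplexCategory.δ (Fin.last 1)) m))⁻¹ =
      m * m' * m⁻¹ := by
  have c := commute_sigma_delta_last hT m ((moore_normal G 1).conj_mem _ hm' m)
  have e : SimplexCategory.σ (Fin.last 0) = SimplexCategory.const ⦋1⦌ ⦋0⦌ 0 :=
    Subsingleton.elim _ _
  rw [e] at c
  have := c.eq
  generalize pull G (SimplexCategory.const ⦋1⦌ ⦋0⦌ 0)
    (pull G (SimplexCategory.δ (Fin.last 1)) m) = w at this ⊢
  rw [mul_inv_eq_iff_eq_mul]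
  calc w * m' = w * m⁻¹ * (m * m' * m⁻¹) * m := by group
    _ = _ := by rw [← this]; group

end SimplicialGroup

namespace SimplicialGroup

variable {G : SimplicialObject GrpCat.{u}}

/-! ### The crossed complex of the Moore complex -/

variable (G) in
/-- The boundary of the Moore complex. -/
def mooreBoundary (n : ℕ) : moore G (n + 1) →* moore G n :=
  ((pull G (SimplexCategory.δ (Fin.last (n + 1)))).comp (moore G (n + 1)).subtype).codRestrict _
    fun z => pull_last_mem_moore G z.2

variable (G) in
/-- The action of `G_0` on the Moore complex by conjugation through the total degeneracy. -/
def mooreAction (n : ℕ) : G _⦋0⦌ →* MulAut (moore G n) :=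
  letI := moore_normal G n
  MulAut.conjNormal.comp (pull G (SimplexCategory.const ⦋n⦌ ⦋0⦌ 0))

@[simp] theorem mooreBoundary_coe (n : ℕ) (z : moore G (n + 1)) :
    (mooreBoundary G n z : G _⦋n⦌) =
      pull G (SimplexCategory.δ (Fin.last (n + 1))) (z : G _⦋n + 1⦌) := rfl

@[simp] theorem mooreAction_coe (n : ℕ) (p : G _⦋0⦌) (z : moore G n) :
    (mooreAction G n p z : G _⦋n⦌) = pull G (SimplexCategory.const ⦋n⦌ ⦋0⦌ 0) p * z *
      (pull G (SimplexCategory.const ⦋n⦌ ⦋0⦌ 0) p)⁻¹ := rfl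

theorem pull_const_delta {n m : ℕ} (f : ⦋n⦌ ⟶ ⦋m⦌) (p : G _⦋0⦌) :
    pull G f (pull G (SimplexCategory.const ⦋m⦌ ⦋0⦌ 0) p) =
      pull G (SimplexCategory.const ⦋n⦌ ⦋0⦌ 0) p := by
  rw [← pull_comp]
  exact congrArg (fun g => pull G g p) (Subsingleton.elim _ _)

/-- The Moore complex as a crossed complex. -/
def mooreCrossedComplex (hT : MooreDegenTrivial G) : CrossedComplex.{u} where
  obj n := moore G n
  d n := mooreBoundary G n
  act n := (mooreAction G (n + 1)).comp (moore G 0).subtype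
  d_act_zero p m := Subtype.ext (by
    change pull G _ (pull G _ (p : G _⦋0⦌) * (m : G _⦋1⦌) * (pull G _ (p : G _⦋0⦌))⁻¹) =
      (p : G _⦋0⦌) * pull G _ (m : G _⦋1⦌) * (p : G _⦋0⦌)⁻¹
    rw [map_mul, map_mul, map_inv, pull_const_delta, SimplexCategory.const_eq_id, pull_id])
  d_act_succ n p x := Subtype.ext (by
    change pull G _ (pull G _ (p : G _⦋0⦌) * (x : G _⦋n + 2⦌) * (pull G _ (p : G _⦋0⦌))⁻¹) =
      pull G _ (p : G _⦋0⦌) * pull G _ (x : G _⦋n + 2⦌) * (pull G _ (p : G _⦋0⦌))⁻¹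
    rw [map_mul, map_mul, map_inv, pull_const_delta])
  peiffer m m' := Subtype.ext (moore_one_peiffer hT m'.2)
  comm n x y := Subtype.ext (moore_commute hT x.2 y.2)
  act_d n m x := Subtype.ext (by
    change pull G (SimplexCategory.const ⦋n + 2⦌ ⦋0⦌ 0)
      (pull G (SimplexCategory.δ (Fin.last 1)) (m : G _⦋1⦌)) * (x : G _⦋n + 2⦌) *
      (pull G (SimplexCategory.const ⦋n + 2⦌ ⦋0⦌ 0)
        (pull G (SimplexCategory.δ (Fin.last 1)) (m : G _⦋1⦌)))⁻¹ = x
    rw [mul_inv_eq_iff_eq_mul]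
    exact (totalDegeneracy_boundary_commute hT m.2 x.2).symm)
  d_d n x := Subtype.ext (by
    change pull G _ (pull G _ (x : G _⦋n + 2⦌)) = 1
    rw [← pull_comp]
    -- The double last face omits n+1 as well as n+2, and d_{n+1} kills x.
    refine pull_eq_one_of_mem_moore G x.2 _ (n + 1) (by omega) fun t => ?_
    rw [comp_val, delta_val, delta_val]
    simp only [Fin.val_last]
    split_ifs <;> omega)

/-! ### The projection onto the Moore complex -/

/-- Since NG ∩ D = 1, the factorisation into a Moore element and an element of D is unique, and the
projection provides one. -/
theorem mooreProj_mul (hT : MooreDegenTrivial G) {n : ℕ} {x d : G _⦋n⦌} (hx : x ∈ moore G n)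
    (hd : d ∈ degen G n) : mooreProj G n (x * d) = ⟨x, hx⟩ := by
  refine Subtype.ext (inv_mul_eq_one.1 (hT n _ (mul_mem (inv_mem (mooreProj G n _).2) hx) ?_))
  have := mul_mem (mooreProj_inv_mul_mem_degen G n (x * d)) (inv_mem hd)
  rwa [mul_assoc, mul_inv_cancel_right] at this

theorem mooreProj_of_mem_degen (hT : MooreDegenTrivial G) {n : ℕ} {d : G _⦋n⦌}
    (hd : d ∈ degen G n) : mooreProj G n d = 1 := by
  have := mooreProj_mul hT (one_mem _) hd
  rwa [one_mul] at this

theorem mooreProj_of_mem_moore (hT : MooreDegenTrivial G) {n : ℕ} {x : G _⦋n⦌}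
    (hx : x ∈ moore G n) : mooreProj G n x = ⟨x, hx⟩ := by
  have := mooreProj_mul hT hx (one_mem _)
  rwa [mul_one] at this

theorem mooreProj_one (hT : MooreDegenTrivial G) (n : ℕ) : mooreProj G n 1 = 1 :=
  mooreProj_of_mem_degen hT (one_mem _)

/-- The projection is a crossed homomorphism. -/
theorem mooreProj_mul_crossed (hT : MooreDegenTrivial G) {n : ℕ} (z z' : G _⦋n + 1⦌) :
    mooreProj G (n + 1) (z * z') = mooreProj G (n + 1) z *
      mooreAction G (n + 1) (pull G (SimplexCategory.const ⦋0⦌ ⦋n + 1⦌ (Fin.last (n + 1))) z)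
        (mooreProj G (n + 1) z') := by
  have hd := mooreProj_inv_mul_mem_degen G (n + 1) z
  have hd' := mooreProj_inv_mul_mem_degen G (n + 1) z'
  have hx := (mooreProj G (n + 1) z).2
  have hy := (mooreProj G (n + 1) z').2
  generalize hxe : (mooreProj G (n + 1) z : G _⦋n + 1⦌) = x at hd hx
  generalize hye : (mooreProj G (n + 1) z' : G _⦋n + 1⦌) = y at hd' hy
  generalize hde : x⁻¹ * z = d at hd
  generalize hde' : y⁻¹ * z' = d' at hd'
  have hz : z = x * d := by rw [← hde]; group
  have hz' : z' = y * d' := by rw [← hde']; group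
  have c := commute_lastVertex_inv_mul hT hd hy
  -- The Moore part x has trivial last vertex, so z and d have the same one; through it d conjugates
  -- y.
  have e : pull G (SimplexCategory.const ⦋n + 1⦌ ⦋0⦌ 0)
      (pull G (SimplexCategory.const ⦋0⦌ ⦋n + 1⦌ (Fin.last (n + 1))) z) =
      pull G (SimplexCategory.const ⦋n + 1⦌ ⦋n + 1⦌ (Fin.last (n + 1))) d := by
    rw [← pull_comp, ← SimplexCategory.const_fac_thru_zero, hz, map_mul,
      pull_const_eq_one hx _ (Fin.last_pos.ne'), one_mul]
  have hconj : d * y * d⁻¹ =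
      pull G (SimplexCategory.const ⦋n + 1⦌ ⦋n + 1⦌ (Fin.last (n + 1))) d * y *
      (pull G (SimplexCategory.const ⦋n + 1⦌ ⦋n + 1⦌ (Fin.last (n + 1))) d)⁻¹ := by
    generalize pull G (SimplexCategory.const ⦋n + 1⦌ ⦋n + 1⦌ (Fin.last (n + 1))) d = w at c
    have := c.eq
    calc d * y * d⁻¹ = w * ((w⁻¹ * d) * y) * d⁻¹ := by group
      _ = _ := by rw [← this]; group
  have hmem : x * (d * y * d⁻¹) ∈ moore G (n + 1) :=
    mul_mem hx ((moore_normal G _).conj_mem _ hy _)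
  have key : z * z' = (x * (d * y * d⁻¹)) * (d * d') := by rw [hz, hz']; group
  refine Subtype.ext ?_
  rw [Subgroup.coe_mul, mooreAction_coe, e, hxe, hye, ← hconj, key,
    mooreProj_mul hT hmem (mul_mem hd hd')]

/-- The composite of δ_i with f omits f(i), and f(i) < f(i+1) ≤ n is not the last vertex. -/
theorem pull_mem_moore_of_injective {n m : ℕ} {f : ⦋m⦌ ⟶ ⦋n⦌} (hf : Function.Injective f.toOrderHom)
    {z : G _⦋n⦌} (hz : z ∈ moore G n) : pull G f z ∈ moore G m := by
  cases m with
  | zero => trivial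
  | succ m =>
    refine mem_moore_of G fun i => ?_
    rw [← pull_comp]
    have h1 : f.toOrderHom i.castSucc < f.toOrderHom i.succ :=
      lt_of_le_of_ne (f.toOrderHom.monotone (Fin.castSucc_le_succ i)) fun h => by
        have := congrArg Fin.val (hf h)
        simp at this
    refine pull_eq_one_of_mem_moore G hz _ (f.toOrderHom i.castSucc) ?_ fun t h => ?_
    · have h2 : (f.toOrderHom i.succ : ℕ) < n + 1 := Fin.is_lt _
      have h3 : (f.toOrderHom i.castSucc : ℕ) < f.toOrderHom i.succ := h1
      omega
    · have h4 := congrArg Fin.val (hf (Fin.ext h))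
      rw [delta_val] at h4
      simp only [Fin.val_castSucc] at h4
      split_ifs at h4 <;> omega

/-! ### The homotopy addition relations -/

theorem mooreProj_boundary_one (w : G _⦋1⦌) :
    pull G (SimplexCategory.δ 1) (mooreProj G 1 w : G _⦋1⦌) =
      pull G (SimplexCategory.δ 1) w * (pull G (SimplexCategory.δ 0) w)⁻¹ := by
  change pull G (SimplexCategory.δ 1)
    (w * (pull G (SimplexCategory.σ 0) (pull G (SimplexCategory.δ 0) w))⁻¹) = _
  rw [map_mul, map_inv]
  exact congrArg (fun x => _ * x⁻¹) (pull_delta_sigma_succ (0 : Fin 1) _)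

/-- The projection onto the Moore complex, with values in the crossed complex. -/
def mooreLabel (hT : MooreDegenTrivial G) (k : ℕ) (w : G _⦋k⦌) : (mooreCrossedComplex hT).obj k :=
  mooreProj G k w

theorem mooreLabel_of_mem_degen (hT : MooreDegenTrivial G) {k : ℕ} {w : G _⦋k⦌}
    (hw : w ∈ degen G k) : mooreLabel hT k w = 1 :=
  mooreProj_of_mem_degen hT hw

theorem mooreLabel_one (hT : MooreDegenTrivial G) (k : ℕ) : mooreLabel hT k 1 = 1 :=
  mooreProj_one hT k

theorem d_mooreLabel_of_mem_moore (hT : MooreDegenTrivial G) {k : ℕ} {w : G _⦋k + 1⦌}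
    (hw : w ∈ moore G (k + 1)) : (mooreCrossedComplex hT).d k (mooreLabel hT (k + 1) w) =
      mooreLabel hT k (pull G (SimplexCategory.δ (Fin.last (k + 1))) w) := by
  unfold mooreLabel
  rw [mooreProj_of_mem_moore hT hw, mooreProj_of_mem_moore hT (pull_last_mem_moore G hw)]
  rfl

/-- The faces j and j+1 of s_j x both equal x and enter with opposite signs; the third face is
degenerate and has trivial label. -/
theorem d_one_mooreLabel_sigma (hT : MooreDegenTrivial G) (j : Fin 2) (x : G _⦋1⦌) :
    (mooreCrossedComplex hT).d 1 (mooreLabel hT 2 (pull G (SimplexCategory.σ j) x)) =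
      mooreLabel hT 1 (pull G (SimplexCategory.δ 2) (pull G (SimplexCategory.σ j) x)) *
      mooreLabel hT 1 (pull G (SimplexCategory.δ 0) (pull G (SimplexCategory.σ j) x)) *
      (mooreLabel hT 1 (pull G (SimplexCategory.δ 1) (pull G (SimplexCategory.σ j) x)))⁻¹ := by
  rw [mooreLabel_of_mem_degen hT (sigma_mem_degen G j x), map_one]
  have hs := pull_delta_sigma_succ j x
  have hc := pull_delta_sigma_castSucc j x
  fin_cases j
  · have h2 := mooreLabel_of_mem_degen hT (pull_delta_sigma_mem_degen (2 : Fin 3) (0 : Fin 2)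
      (by simp) (by simp) x)
    change pull G (SimplexCategory.δ 1) (pull G (SimplexCategory.σ 0) x) = x at hs
    change pull G (SimplexCategory.δ 0) (pull G (SimplexCategory.σ 0) x) = x at hc
    simp only [Fin.zero_eta]
    rw [h2, hs, hc, one_mul, mul_inv_cancel]
  · have h2 := mooreLabel_of_mem_degen hT (pull_delta_sigma_mem_degen (0 : Fin 3) (1 : Fin 2)
      (by simp) (by simp) x)
    change pull G (SimplexCategory.δ 2) (pull G (SimplexCategory.σ 1) x) = x at hs
    change pull G (SimplexCategory.δ 1) (pull G (SimplexCategory.σ 1) x) = x at hc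
    simp only [Fin.mk_one]
    rw [h2, hs, hc, mul_one, mul_inv_cancel]

theorem d_one_mooreLabel_moore (hT : MooreDegenTrivial G) {w : G _⦋2⦌} (hw : w ∈ moore G 2) :
    (mooreCrossedComplex hT).d 1 (mooreLabel hT 2 w) =
      mooreLabel hT 1 (pull G (SimplexCategory.δ 2) w) *
      mooreLabel hT 1 (pull G (SimplexCategory.δ 0) w) *
      (mooreLabel hT 1 (pull G (SimplexCategory.δ 1) w))⁻¹ := by
  have h0 : pull G (SimplexCategory.δ 0) w = 1 := (mem_moore_succ G).1 hw 0
  have h1 : pull G (SimplexCategory.δ 1) w = 1 := (mem_moore_succ G).1 hw 1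
  rw [h0, h1, mooreLabel_one, mul_one, inv_one, mul_one]
  exact d_mooreLabel_of_mem_moore hT hw

theorem d_mooreLabel_sigma (hT : MooreDegenTrivial G) (k : ℕ) (j : Fin (k + 3)) (x : G _⦋k + 2⦌) :
    (mooreCrossedComplex hT).d (k + 2) (mooreLabel hT (k + 3) (pull G (SimplexCategory.σ j) x)) =
      ∏ i : Fin (k + 4), mooreLabel hT (k + 2) (pull G (SimplexCategory.δ i)
        (pull G (SimplexCategory.σ j) x)) ^ ((-1 : ℤ) ^ (k + 3 + (i : ℕ))) := by
  rw [mooreLabel_of_mem_degen hT (sigma_mem_degen G j x), map_one,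
    Finset.prod_eq_mul j.castSucc j.succ (fun h => by
      have := congrArg Fin.val h
      simp at this)]
  · rw [pull_delta_sigma_castSucc, pull_delta_sigma_succ, ← zpow_add, Fin.val_castSucc,
      Fin.val_succ, ← add_assoc, pow_succ (-1 : ℤ)]
    simp
  · rintro i - ⟨h1, h2⟩
    rw [mooreLabel_of_mem_degen hT (pull_delta_sigma_mem_degen i j
      (fun h => h1 (Fin.ext h)) (fun h => h2 (Fin.ext h)) x), one_zpow]
  · simp
  · simp

theorem d_mooreLabel_moore (hT : MooreDegenTrivial G) (k : ℕ) {w : G _⦋k + 3⦌}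
    (hw : w ∈ moore G (k + 3)) :
    (mooreCrossedComplex hT).d (k + 2) (mooreLabel hT (k + 3) w) =
      ∏ i : Fin (k + 4), mooreLabel hT (k + 2) (pull G (SimplexCategory.δ i) w) ^
        ((-1 : ℤ) ^ (k + 3 + (i : ℕ))) := by
  rw [Fin.prod_univ_castSucc, Finset.prod_eq_one, one_mul]
  · rw [Fin.val_last, Even.neg_one_pow ⟨k + 3, rfl⟩, zpow_one]
    exact d_mooreLabel_of_mem_moore hT hw
  · intro i _
    rw [show pull G (SimplexCategory.δ i.castSucc) w = 1 from (mem_moore_succ G).1 hw i,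
      mooreLabel_one, one_zpow]

/-! ### The comparison with the nerve -/

/-- The labelling `c` of the faces of `Δ^n` consists of the projections of the faces of `z`. -/
def IsLabelling (hT : MooreDegenTrivial G) {n : ℕ} (z : G _⦋n⦌)
    (c : (mooreCrossedComplex hT).NerveSimplex n) : Prop :=
  (∀ i, c.vertex i = mooreLabel hT 0 (pull G (SimplexCategory.const ⦋0⦌ ⦋n⦌ i) z)) ∧
    ∀ k f, c.label k f = mooreLabel hT (k + 1) (pull G f z)

theorem IsLabelling.unique {hT : MooreDegenTrivial G} {n : ℕ} {z : G _⦋n⦌}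
    {c c' : (mooreCrossedComplex hT).NerveSimplex n} (h : IsLabelling hT z c)
    (h' : IsLabelling hT z c') : c = c' := by
  ext
  · rw [h.1, h'.1]
  · rw [h.2, h'.2]

theorem IsLabelling.one (hT : MooreDegenTrivial G) (n : ℕ) :
    IsLabelling hT (1 : G _⦋n⦌) 1 := by
  constructor
  · intro i
    rw [map_one, mooreLabel_one]
    rfl
  · intro k f
    rw [map_one, mooreLabel_one]
    rfl

theorem IsLabelling.mul {hT : MooreDegenTrivial G} {n : ℕ} {z z' : G _⦋n⦌}
    {c c' : (mooreCrossedComplex hT).NerveSimplex n} (h : IsLabelling hT z c)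
    (h' : IsLabelling hT z' c') : IsLabelling hT (z * z') (c * c') := by
  constructor
  · intro i
    rw [CrossedComplex.NerveSimplex.mul_vertex, h.1, h'.1, map_mul]
    rfl
  · intro k f
    rw [CrossedComplex.NerveSimplex.mul_label, h.1, h.2, h'.2, map_mul]
    have e := mooreProj_mul_crossed hT (pull G f z) (pull G f z')
    rw [← pull_comp, SimplexCategory.const_comp] at e
    exact e.symm

theorem IsLabelling.inv {hT : MooreDegenTrivial G} {n : ℕ} {z : G _⦋n⦌}
    {c : (mooreCrossedComplex hT).NerveSimplex n} (h : IsLabelling hT z c) :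
    IsLabelling hT z⁻¹ c⁻¹ := by
  constructor
  · intro i
    rw [CrossedComplex.NerveSimplex.inv_vertex, h.1, map_inv]
    rfl
  · intro k f
    rw [CrossedComplex.NerveSimplex.inv_label, h.1, h.2]
    have e := mooreProj_mul_crossed hT (pull G f z)⁻¹ (pull G f z)
    rw [inv_mul_cancel, mooreProj_one hT, map_inv, ← pull_comp, SimplexCategory.const_comp] at e
    rw [map_inv ((mooreCrossedComplex hT).act k _), map_inv (pull G f)]
    exact (eq_inv_of_mul_eq_one_left e.symm).symm

theorem IsLabelling.restrict {hT : MooreDegenTrivial G} {n m : ℕ} {z : G _⦋n⦌}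
    {c : (mooreCrossedComplex hT).NerveSimplex n} (h : IsLabelling hT z c) (θ : ⦋m⦌ ⟶ ⦋n⦌) :
    IsLabelling hT (pull G θ z) (CrossedComplex.NerveSimplex.restrict θ c) := by
  constructor
  · intro i
    rw [← pull_comp]
    exact h.1 _
  · intro k f
    rw [← pull_comp]
    exact h.2 k _

/-- Each f^* z is a Moore element (f injective) or of the form s_j x, so in dimensions ≥ 2 the
boundary relations need only be checked in these two cases. -/
theorem exists_isLabelling_of_mem_moore (hT : MooreDegenTrivial G) {n : ℕ} {z : G _⦋n⦌}
    (hz : z ∈ moore G n) : ∃ c, IsLabelling hT z c :=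
  ⟨{ vertex := fun i => mooreLabel hT 0 (pull G (SimplexCategory.const ⦋0⦌ ⦋n⦌ i) z)
     label := fun k f => mooreLabel hT (k + 1) (pull G f z)
     label_degenerate := fun k f hf => mooreLabel_of_mem_degen hT (pull_mem_degen G f hf z)
     boundary_one := fun f => by
       have h := mooreProj_boundary_one (pull G f z)
       rw [← pull_comp, ← pull_comp] at h
       refine Subtype.ext (h.trans ?_)
       have e1 : SimplexCategory.δ 1 ≫ f = SimplexCategory.const ⦋0⦌ ⦋n⦌ (f.toOrderHom 0) :=
         SimplexCategory.Hom.ext_zero_left _ _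
       have e0 : SimplexCategory.δ 0 ≫ f = SimplexCategory.const ⦋0⦌ ⦋n⦌ (f.toOrderHom 1) :=
         SimplexCategory.Hom.ext_zero_left _ _
       rw [e1, e0]
       rfl
     boundary_two := fun f => by
       simp only [pull_comp]
       by_cases hf : Function.Injective f.toOrderHom
       · exact d_one_mooreLabel_moore hT (pull_mem_moore_of_injective hf hz)
       · obtain ⟨j, g, rfl⟩ := SimplexCategory.eq_σ_comp_of_not_injective f hf
         rw [pull_comp]
         exact d_one_mooreLabel_sigma hT j _
     boundary_succ := fun k f => by
       simp only [pull_comp]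
       by_cases hf : Function.Injective f.toOrderHom
       · exact d_mooreLabel_moore hT k (pull_mem_moore_of_injective hf hz)
       · obtain ⟨j, g, rfl⟩ := SimplexCategory.eq_σ_comp_of_not_injective f hf
         rw [pull_comp]
         exact d_mooreLabel_sigma hT k j _ }, fun _ => rfl, fun _ _ => rfl⟩

/-- The elements with a labelling form a subgroup containing NG and, by induction on the dimension,
the degenerate elements. The boundary relations for products thus come from the group structure of
the nerve. -/
theorem exists_isLabelling (hT : MooreDegenTrivial G) {n : ℕ} (z : G _⦋n⦌) :
    ∃ c, IsLabelling hT z c := by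
  induction n with
  | zero => exact exists_isLabelling_of_mem_moore hT trivial
  | succ n ih =>
    obtain ⟨c, hc⟩ := exists_isLabelling_of_mem_moore hT (mooreProj G (n + 1) z).2
    obtain ⟨c', hc'⟩ := degen_induction G (p := fun d => ∃ c, IsLabelling hT d c)
      (mooreProj_inv_mul_mem_degen G (n + 1) z)
      (fun i x => let ⟨c, hc⟩ := ih x; ⟨_, hc.restrict (SimplexCategory.σ i)⟩)
      ⟨1, IsLabelling.one hT _⟩ (fun _ _ ⟨c, hc⟩ ⟨c', hc'⟩ => ⟨c * c', hc.mul hc'⟩)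
      (fun _ ⟨c, hc⟩ => ⟨c⁻¹, hc.inv⟩)
    have := hc.mul hc'
    rw [mul_inv_cancel_left] at this
    exact ⟨_, this⟩

/-- The homomorphism from `G_n` to the `n`-simplices of the nerve of its crossed complex. -/
noncomputable def nerveHom (hT : MooreDegenTrivial G) (n : ℕ) :
    G _⦋n⦌ →* (mooreCrossedComplex hT).NerveSimplex n :=
  MonoidHom.mk' (fun z => (exists_isLabelling hT z).choose) fun z z' =>
    (exists_isLabelling hT (z * z')).choose_spec.unique
      ((exists_isLabelling hT z).choose_spec.mul (exists_isLabelling hT z').choose_spec)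

theorem isLabelling_nerveHom (hT : MooreDegenTrivial G) {n : ℕ} (z : G _⦋n⦌) :
    IsLabelling hT z (nerveHom hT n z) :=
  (exists_isLabelling hT z).choose_spec

theorem nerveHom_pull (hT : MooreDegenTrivial G) {n m : ℕ} (θ : ⦋m⦌ ⟶ ⦋n⦌) (z : G _⦋n⦌) :
    nerveHom hT m (pull G θ z) = CrossedComplex.NerveSimplex.restrict θ (nerveHom hT n z) :=
  (isLabelling_nerveHom hT _).unique ((isLabelling_nerveHom hT z).restrict θ)

/-- The faces of a kernel element are kernel elements, trivial by induction. The element is then in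
the Moore complex and equals its own top label. -/
theorem nerveHom_injective (hT : MooreDegenTrivial G) (n : ℕ) :
    Function.Injective (nerveHom hT n) := by
  refine (injective_iff_map_eq_one _).2 fun z hz => ?_
  have hl := isLabelling_nerveHom hT z
  rw [hz] at hl
  cases n with
  | zero =>
    have h := congrArg Subtype.val (hl.1 0)
    rw [SimplexCategory.const_eq_id, pull_id] at h
    exact h.symm
  | succ n =>
    have h := hl.2 n (𝟙 _)
    have hm : z ∈ moore G (n + 1) := by
      refine mem_moore_of G fun i => nerveHom_injective hT n ?_
      rw [nerveHom_pull, hz, map_one, map_one]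
    rw [pull_id, mooreLabel, mooreProj_of_mem_moore hT hm] at h
    exact (congrArg Subtype.val h).symm

end SimplicialGroup

namespace CrossedComplex

open SimplicialGroup

variable {C : CrossedComplex.{u}}

/-! ### The Moore complex of the nerve -/

/-- A map to [n+1] is non-surjective and factors through a face, or non-injective and has trivial
label, or is the identity. -/
theorem NerveSimplex.eq_one_of_faces {n : ℕ} {c : C.NerveSimplex (n + 1)}
    (h : ∀ i : Fin (n + 2), NerveSimplex.restrict (SimplexCategory.δ i) c = 1)
    (hl : c.label n (𝟙 _) = 1) : c = 1 := by
  have key : ∀ (k : ℕ) (f : ⦋k⦌ ⟶ ⦋n + 1⦌), ¬ Function.Surjective f.toOrderHom →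
      NerveSimplex.restrict f c = 1 := fun k f hf => by
    obtain ⟨i, g, rfl⟩ := SimplexCategory.eq_comp_δ_of_not_surjective f hf
    exact (congrArg (NerveSimplex.restrict g) (h i)).trans (map_one _)
  refine NerveSimplex.ext (funext fun i => ?_) (funext fun k => funext fun f => ?_)
  · have := key 0 (SimplexCategory.const _ _ i) fun hf => by
      obtain ⟨s, hs⟩ := hf (0 : Fin (n + 2))
      obtain ⟨t, ht⟩ := hf (1 : Fin (n + 2))
      have h01 : (0 : Fin (n + 2)) = 1 := hs.symm.trans ht
      simp at h01
    exact congrArg (fun c => NerveSimplex.vertex c 0) this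
  · by_cases hi : Function.Injective f.toOrderHom
    · by_cases hs : Function.Surjective f.toOrderHom
      · have h1 := Fintype.card_le_of_injective _ hi
        have h2 := Fintype.card_le_of_surjective _ hs
        simp only [SimplexCategory.len_mk, Fintype.card_fin] at h1 h2
        obtain rfl : k = n := by omega
        have : Epi f := SimplexCategory.epi_iff_surjective.2 hs
        rw [SimplexCategory.eq_id_of_epi f]
        exact hl
      · have := congrArg (fun c => NerveSimplex.label c k (𝟙 _)) (key _ f hs)
        change c.label k (𝟙 _ ≫ f) = 1 at this
        rwa [Category.id_comp] at this
    · exact c.label_degenerate k f hi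

/-- An element of the Moore complex of the nerve is determined by its top label. -/
theorem eq_one_of_mem_moore_nerve {n : ℕ} {c : C.NerveSimplex (n + 1)}
    (hc : (c : C.nerve _⦋n + 1⦌) ∈ moore C.nerve (n + 1)) (hl : c.label n (𝟙 _) = 1) : c = 1 := by
  have hface : ∀ i : Fin (n + 1),
      NerveSimplex.restrict (SimplexCategory.δ i.castSucc) c = 1 := (mem_moore_succ _).1 hc
  -- The last face is again a Moore element, so by recursion its top label decides; the boundary
  -- relation of c identifies that label with the boundary of the top label of c, which is 1.
  suffices hlast : NerveSimplex.restrict (SimplexCategory.δ (Fin.last (n + 1))) c = 1 from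
    NerveSimplex.eq_one_of_faces (Fin.lastCases hlast hface) hl
  cases n with
  | zero =>
    have h1 : c.vertex 1 = 1 := congrArg (fun c => NerveSimplex.vertex c 0) (hface 0)
    have h2 := c.boundary_one (𝟙 _)
    rw [hl, map_one] at h2
    change 1 = c.vertex 0 * (c.vertex 1)⁻¹ at h2
    rw [h1, inv_one, mul_one] at h2
    refine NerveSimplex.ext (funext fun i => ?_) (funext fun k => funext fun f => ?_)
    · obtain rfl : i = 0 := Subsingleton.elim (α := Fin 1) i 0
      exact h2.symm
    · refine NerveSimplex.label_degenerate _ k f fun h => ?_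
      have h01 : (⟨0, by omega⟩ : Fin (k + 2)) = ⟨1, by omega⟩ :=
        h (Subsingleton.elim (α := Fin 1) _ _)
      simp at h01
  | succ n =>
    refine eq_one_of_mem_moore_nerve (pull_last_mem_moore C.nerve hc) ?_
    change c.label n (𝟙 _ ≫ SimplexCategory.δ (Fin.last (n + 2))) = 1
    rw [Category.id_comp]
    have hlab : ∀ i : Fin (n + 2), c.label n (SimplexCategory.δ i.castSucc) = 1 := fun i => by
      have := congrArg (fun c => NerveSimplex.label c n (𝟙 _)) (hface i)
      change c.label n (𝟙 _ ≫ SimplexCategory.δ i.castSucc) = 1 at this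
      rwa [Category.id_comp] at this
    cases n with
    | zero =>
      have h := c.boundary_two (𝟙 _)
      rw [hl, map_one, Category.comp_id, Category.comp_id, Category.comp_id] at h
      have h0 : c.label 0 (SimplexCategory.δ 0) = 1 := hlab 0
      have h1 : c.label 0 (SimplexCategory.δ 1) = 1 := hlab 1
      rw [h0, h1, mul_one, inv_one, mul_one] at h
      exact h.symm
    | succ n =>
      have h := c.boundary_succ n (𝟙 _)
      simp only [Category.comp_id] at h
      rw [hl, map_one, Fin.prod_univ_castSucc, Finset.prod_eq_one, one_mul, Fin.val_last,
        Even.neg_one_pow ⟨n + 3, rfl⟩, zpow_one] at h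
      · exact h.symm
      · intro i _
        rw [hlab i, one_zpow]

/-- By the twisted product formula, trivial top labels are preserved by products and inverses; on
s_i x the top label is that of the non-injective map σ_i. -/
theorem label_of_mem_degen {n : ℕ} {c : C.NerveSimplex (n + 1)}
    (hc : (c : C.nerve _⦋n + 1⦌) ∈ degen C.nerve (n + 1)) : c.label n (𝟙 _) = 1 := by
  refine degen_induction C.nerve
    (p := fun c => NerveSimplex.label (C := C) (n := n + 1) c n (𝟙 _) = 1) hc ?_ rfl ?_ ?_
  · intro i x
    change NerveSimplex.label (C := C) (n := n) x n (𝟙 _ ≫ SimplexCategory.σ i) = 1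
    rw [Category.id_comp]
    exact NerveSimplex.label_degenerate _ _ _ (sigma_not_injective i)
  · intro x y hx hy
    refine (NerveSimplex.mul_label (C := C) x y n (𝟙 _)).trans ?_
    rw [hx, hy, map_one, mul_one]
  · intro x hx
    refine (NerveSimplex.inv_label (C := C) x n (𝟙 _)).trans ?_
    rw [hx, inv_one, map_one]

theorem nerve_mooreDegenTrivial (C : CrossedComplex.{u}) : MooreDegenTrivial C.nerve := by
  intro n c hc hc'
  cases n with
  | zero => exact degen_zero _ hc'
  | succ n => exact eq_one_of_mem_moore_nerve hc (label_of_mem_degen hc')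

end CrossedComplex

/-! ### Invariance under isomorphism, and the isomorphism with the nerve -/

namespace SimplicialGroup

variable {G H : SimplicialObject GrpCat.{u}}

theorem pull_naturality (φ : G ⟶ H) {m n : ℕ} (f : ⦋m⦌ ⟶ ⦋n⦌) (z : G _⦋n⦌) :
    φ.app (op ⦋m⦌) (pull G f z) = pull H f (φ.app (op ⦋n⦌) z) :=
  ConcreteCategory.congr_hom (φ.naturality f.op) z

theorem MooreDegenTrivial.of_iso (hT : MooreDegenTrivial H) (e : G ≅ H) : MooreDegenTrivial G := by
  intro n z hz hz'
  cases n with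
  | zero => exact degen_zero _ hz'
  | succ n =>
    have h1 : e.hom.app (op ⦋n + 1⦌) z ∈ moore H (n + 1) := mem_moore_of H fun i => by
      rw [← pull_naturality, show pull G (SimplexCategory.δ i.castSucc) z = 1 from
        (mem_moore_succ G).1 hz i, map_one]
    have h2 : e.hom.app (op ⦋n + 1⦌) z ∈ degen H (n + 1) := by
      refine degen_induction G (p := fun z => e.hom.app (op ⦋n + 1⦌) z ∈ degen H (n + 1)) hz' ?_ ?_
        ?_ ?_
      · intro i x
        rw [pull_naturality]
        exact sigma_mem_degen H i _
      · rw [map_one]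
        exact one_mem _
      · intro x y hx hy
        rw [map_mul]
        exact mul_mem hx hy
      · intro x hx
        rw [map_inv]
        exact inv_mem hx
    have h3 := hT _ _ h1 h2
    have h4 := ConcreteCategory.congr_hom (e.hom_inv_id_app (op ⦋n + 1⦌)) z
    rw [ConcreteCategory.comp_apply, h3, map_one] at h4
    exact h4.symm

/-- The elements of the crossed complex as elements of `G`. -/
def mooreValue (hT : MooreDegenTrivial G) {n : ℕ} (x : (mooreCrossedComplex hT).obj n) : G _⦋n⦌ :=
  Subtype.val (p := (· ∈ moore G n)) x

/-- The range contains the degenerate elements by induction. It contains the Moore complex of the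
nerve because the top label u of such an element lies in NG, and the image of u is a Moore element
with the same top label. Together these generate the nerve. -/
theorem nerveHom_surjective (hT : MooreDegenTrivial G) (n : ℕ) :
    Function.Surjective (nerveHom hT n) := by
  set C := mooreCrossedComplex hT
  induction n with
  | zero =>
    intro c
    refine ⟨mooreValue hT (c.vertex 0), ?_⟩
    have hl := isLabelling_nerveHom hT (mooreValue hT (c.vertex 0))
    refine CrossedComplex.NerveSimplex.ext (funext fun i => ?_)
      (funext fun k => funext fun f => ?_)
    · obtain rfl : i = 0 := Subsingleton.elim (α := Fin 1) i 0
      rw [hl.1, SimplexCategory.const_eq_id, pull_id]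
      rfl
    · have hf : ¬ Function.Injective f.toOrderHom := fun h => by
        have h01 : (⟨0, by omega⟩ : Fin (k + 2)) = ⟨1, by omega⟩ :=
          h (Subsingleton.elim (α := Fin 1) _ _)
        simp at h01
      rw [CrossedComplex.NerveSimplex.label_degenerate _ k f hf,
        CrossedComplex.NerveSimplex.label_degenerate _ k f hf]
  | succ n ih =>
    have hmoore : ∀ c : C.NerveSimplex (n + 1), (c : C.nerve _⦋n + 1⦌) ∈ moore C.nerve (n + 1) →
        c ∈ (nerveHom hT (n + 1)).range := by
      intro c hc
      have hu : mooreValue hT (c.label n (𝟙 _)) ∈ moore G (n + 1) :=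
        Subtype.prop _
      have hul : mooreLabel hT (n + 1) (mooreValue hT (c.label n (𝟙 _))) =
          c.label n (𝟙 _) := mooreProj_of_mem_moore hT hu
      generalize mooreValue hT (c.label n (𝟙 _)) = u at hu hul
      have hl := isLabelling_nerveHom hT u
      have hum : (nerveHom hT (n + 1) u : C.nerve _⦋n + 1⦌) ∈ moore C.nerve (n + 1) :=
        mem_moore_of C.nerve fun i => by
          refine (nerveHom_pull hT (SimplexCategory.δ i.castSucc) u).symm.trans ?_
          rw [show pull G (SimplexCategory.δ i.castSucc) u = 1 from (mem_moore_succ G).1 hu i]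
          exact map_one _
      refine ⟨u, (inv_mul_eq_one.1 (CrossedComplex.eq_one_of_mem_moore_nerve
        (mul_mem (inv_mem hum) hc) ?_))⟩
      rw [CrossedComplex.NerveSimplex.mul_label, CrossedComplex.NerveSimplex.inv_label, hl.2,
        pull_id, hul, CrossedComplex.NerveSimplex.inv_vertex, ← map_mul, inv_mul_cancel, map_one]
    intro c
    have h1 := hmoore _ (mooreProj C.nerve (n + 1) c).2
    have h2 := degen_induction C.nerve
      (p := fun c => (c : C.NerveSimplex (n + 1)) ∈ (nerveHom hT (n + 1)).range)
      (mooreProj_inv_mul_mem_degen C.nerve (n + 1) c)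
      (fun i x => by
        obtain ⟨z, hz⟩ := ih x
        exact ⟨pull G (SimplexCategory.σ i) z, (nerveHom_pull hT _ z).trans
          (congrArg (CrossedComplex.NerveSimplex.restrict (SimplexCategory.σ i)) hz)⟩)
      (one_mem _) (fun _ _ => mul_mem) (fun _ => inv_mem)
    have h3 := mul_mem h1 h2
    exact (mul_inv_cancel_left (mooreProj C.nerve (n + 1) c : C.nerve _⦋n + 1⦌) c) ▸ h3

/-- A simplicial group whose Moore complex contains no nontrivial product of degenerate elements is
the nerve of its crossed complex. -/
noncomputable def nerveIso (hT : MooreDegenTrivial G) : G ≅ (mooreCrossedComplex hT).nerve :=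
  NatIso.ofComponents
    (fun X => (MulEquiv.ofBijective (nerveHom hT X.unop.len)
      ⟨nerveHom_injective hT _, nerveHom_surjective hT _⟩).toGrpIso)
    (fun {X Y} f => by
      ext z
      exact nerveHom_pull hT (n := X.unop.len) (m := Y.unop.len) f.unop z)

theorem mooreIsCrossedComplex_of_mooreDegenTrivial (hT : MooreDegenTrivial G) :
    MooreIsCrossedComplex G :=
  ⟨mooreCrossedComplex hT, fun n => MulEquiv.refl (moore G n), fun _ _ => rfl, fun _ _ _ => rfl,
    ⟨(nerveIso hT).symm⟩⟩

end SimplicialGroup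

theorem corollary4p3 (G : SimplicialObject GrpCat.{u}) :
    SimplicialGroup.MooreIsCrossedComplex G ↔
      ∀ (n a b : ℕ) (α : ⦋n⦌ ⟶ ⦋a⦌) (β : ⦋n⦌ ⟶ ⦋b⦌), SimplicialGroup.IsPeifferPair α β →
        ∀ (x : SimplicialGroup.moore G a) (y : SimplicialGroup.moore G b),
          SimplicialGroup.peifferPairing G α β x y = 1 := by
  constructor
  · rintro ⟨C, -, -, -, ⟨e⟩⟩ n a b α β h x y
    exact SimplicialGroup.peifferPairing_eq_one G
      (C.nerve_mooreDegenTrivial.of_iso e.symm) h x y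
  · intro h
    exact SimplicialGroup.mooreIsCrossedComplex_of_mooreDegenTrivial
      (SimplicialGroup.mooreDegenTrivial_of_peifferTrivial h)
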